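/- Let $k$ be a field of positive characteristic $p$. A locally finite iterative higher derivation on a commutative $k$-algebra $B$ is a $k$-algebra homomorphism $\theta: B\to B[U]$, $\theta(b)=\sum_{n\ge 0}\theta^{(n)}(b)U^n$, such that $\theta^{(0)}=\mathrm{id}_B$ and $\theta^{(j)}(\theta^{(n)}(b))=\binom{j+n}{j}\theta^{(j+n)}(b)$ for all $j,n\ge 0$ and $b\in B$; its ring of invariants is the $k$-algebra $B^\theta=\{b\in B : \theta^{(n)}(b)=0 \text{ for all } n\ge 1\}$. Consider the following three polynomial rings, each with the locally finite iterative higher derivation $\theta$ given on the variables as follows. (DF5, Daigle–Freudenburg) $B_5=k[x,s,t,u,v]$ with $\theta(x)=x$, $\theta(s)=s+x^3U$, $\theta(t)=t+2sU+x^3U^2$, $\theta(u)=u+3tU+3sU^2+x^3U^3$, $\theta(v)=v+x^2U$. (F6, Freudenburg) $B_6=k[x,y,s,t,u,v]$ with $\theta(x)=x$, $\theta(y)=y$, $\theta(s)=s+x^3U$, $\theta(t)=t+2y^3sU+x^3y^3U^2$, $\theta(u)=u+3y^3tU+3y^6sU^2+x^3y^6U^3$, $\theta(v)=v+x^2y^2U$.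 (R7, Roberts) $B_7=k[x_1,x_2,x_3,y_1,y_2,y_3,v]$ with $\theta(x_i)=x_i$, $\theta(y_i)=y_i+x_i^3U$ for $i=1,2,3$, and $\theta(v)=v+x_1^2x_2^2x_3^2U$. Theorem. The rings of invariants $B_5^\theta$, $B_6^\theta$ and $B_7^\theta$ are finitely generated $k$-algebras. -/

import Mathlib

noncomputable section

/-- A locally finite iterative higher derivation on a commutative `k`-algebra `B`:
a `k`-algebra homomorphism `θ : B → B[U]`, `θ b = ∑ θ⁽ⁿ⁾(b) Uⁿ`, whose coefficient maps satisfy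
`θ⁽⁰⁾ = id` and `θ⁽ʲ⁾(θ⁽ⁿ⁾(b)) = binom(j + n, j) θ⁽ʲ⁺ⁿ⁾(b)`.
(The Leibniz rule and local finiteness are the fact that `θ` is an algebra homomorphism with
values in polynomials.) -/
structure LFIHD (k B : Type*) [Field k] [CommRing B] [Algebra k B] where
  /-- The homomorphism `θ : B → B[U]`. -/
  toAlgHom : B →ₐ[k] Polynomial B
  coeff_zero : ∀ b : B, (toAlgHom b).coeff 0 = b
  iterative : ∀ (j n : ℕ) (b : B),
    (toAlgHom ((toAlgHom b).coeff n)).coeff j = (j + n).choose j • (toAlgHom b).coeff (j + n)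

namespace LFIHD

/-- The `n`-th component `θ⁽ⁿ⁾ : B → B`, i.e. the coefficient of `Uⁿ` in `θ`. -/
def component {k B : Type*} [Field k] [CommRing B] [Algebra k B] (θ : LFIHD k B)
    (n : ℕ) (b : B) : B :=
  (θ.toAlgHom b).coeff n

/-- The ring of invariants `B^θ = {b ∈ B | θ⁽ⁿ⁾(b) = 0 for all n ≥ 1}`. -/
def invariants {k B : Type*} [Field k] [CommRing B] [Algebra k B] (θ : LFIHD k B) :
    Subalgebra k B where
  carrier := {b | ∀ n : ℕ, 1 ≤ n → θ.component n b = 0}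
  mul_mem' := by
    intro a b ha hb n hn
    simp only [component, map_mul, Polynomial.coeff_mul]
    refine Finset.sum_eq_zero fun ij hij => ?_
    have h : ij.1 + ij.2 = n := Finset.HasAntidiagonal.mem_antidiagonal.mp hij
    rcases Nat.eq_zero_or_pos ij.1 with h1 | h1
    · have h2 : (θ.toAlgHom b).coeff ij.2 = 0 := hb ij.2 (by omega)
      rw [h2, mul_zero]
    · have h2 : (θ.toAlgHom a).coeff ij.1 = 0 := ha ij.1 h1
      rw [h2, zero_mul]
  add_mem' := by
    intro a b ha hb n hn
    have h1 : (θ.toAlgHom a).coeff n = 0 := ha n hn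
    have h2 : (θ.toAlgHom b).coeff n = 0 := hb n hn
    simp [component, h1, h2]
  algebraMap_mem' := by
    intro r n hn
    have h : n ≠ 0 := by omega
    simp [component, AlgHom.commutes, Polynomial.algebraMap_apply, Polynomial.coeff_C, h]

/-- The higher derivation on `k[X_i : i ∈ σ]` with prescribed values `g i = θ(X_i)`. The defining
properties only have to be checked on the variables; `iterative` is the identity
`θ_V ∘ θ_U = θ_{U+V}` on the variables. -/
def ofVars {k σ : Type*} [Field k] (g : σ → Polynomial (MvPolynomial σ k))
    (h0 : ∀ i, (g i).coeff 0 = MvPolynomial.X i)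
    (h1 : ∀ i, (g i).map (MvPolynomial.aeval g : MvPolynomial σ k →ₐ[k] _).toRingHom =
      Polynomial.taylor Polynomial.X ((g i).map Polynomial.C)) :
    LFIHD k (MvPolynomial σ k) where
  toAlgHom := MvPolynomial.aeval g
  coeff_zero := by
    intro b
    have h : (Polynomial.constantCoeff (R := MvPolynomial σ k)).comp
        (MvPolynomial.aeval g : MvPolynomial σ k →ₐ[k] _).toRingHom = RingHom.id _ := by
      apply MvPolynomial.ringHom_ext
      · intro r
        simp [Polynomial.algebraMap_apply]
      · intro i
        simp [h0]
    exact congrArg (fun f : MvPolynomial σ k →+* MvPolynomial σ k => f b) h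
  iterative := by
    intro j n b
    have h : (Polynomial.mapRingHom (MvPolynomial.aeval g : MvPolynomial σ k →ₐ[k] _).toRingHom).comp
        (MvPolynomial.aeval g : MvPolynomial σ k →ₐ[k] _).toRingHom =
        ((Polynomial.taylorAlgHom
          (Polynomial.X : Polynomial (MvPolynomial σ k))).toRingHom.comp
          (Polynomial.mapRingHom Polynomial.C)).comp
          (MvPolynomial.aeval g : MvPolynomial σ k →ₐ[k] _).toRingHom := by
      apply MvPolynomial.ringHom_ext
      · intro r
        simp [Polynomial.algebraMap_apply]
      · intro i
        simpa using h1 i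
    have h2 := congrArg (fun f : MvPolynomial σ k →+* Polynomial (Polynomial (MvPolynomial σ k)) =>
      ((f b).coeff n).coeff j) h
    simp only [RingHom.comp_apply, Polynomial.coe_mapRingHom, Polynomial.coeff_map] at h2
    refine Eq.trans h2 ?_
    change (((Polynomial.taylor Polynomial.X
      ((MvPolynomial.aeval g b).map Polynomial.C)).coeff n).coeff j) = _
    rw [Polynomial.taylor_coeff]
    have h3 : Polynomial.hasseDeriv n ((MvPolynomial.aeval g b).map Polynomial.C) =
        (Polynomial.hasseDeriv n (MvPolynomial.aeval g b)).map
          (Polynomial.C (R := MvPolynomial σ k)) := by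
      ext m : 1
      simp [Polynomial.hasseDeriv_coeff]
    rw [h3, Polynomial.eval_map, Polynomial.eval₂_C_X, Polynomial.hasseDeriv_coeff, nsmul_eq_mul,
      Nat.choose_symm_add]

end LFIHD

section Examples

open MvPolynomial

/-- Values of `θ` on the variables of `B₅ = k[x, s, t, u, v]`
(in this order, `x = X 0, …, v = X 4`). -/
def df5Vars (k : Type*) [Field k] : Fin 5 → Polynomial (MvPolynomial (Fin 5) k) :=
  let U : Polynomial (MvPolynomial (Fin 5) k) := Polynomial.X
  let x := Polynomial.C (X 0)
  let s := Polynomial.C (X 1)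
  let t := Polynomial.C (X 2)
  let u := Polynomial.C (X 3)
  let v := Polynomial.C (X 4)
  ![x,
    s + x ^ 3 * U,
    t + 2 * s * U + x ^ 3 * U ^ 2,
    u + 3 * t * U + 3 * s * U ^ 2 + x ^ 3 * U ^ 3,
    v + x ^ 2 * U]

/-- Values of `θ` on the variables of `B₆ = k[x, y, s, t, u, v]`
(in this order, `x = X 0, …, v = X 5`). -/
def f6Vars (k : Type*) [Field k] : Fin 6 → Polynomial (MvPolynomial (Fin 6) k) :=
  let U : Polynomial (MvPolynomial (Fin 6) k) := Polynomial.X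
  let x := Polynomial.C (X 0)
  let y := Polynomial.C (X 1)
  let s := Polynomial.C (X 2)
  let t := Polynomial.C (X 3)
  let u := Polynomial.C (X 4)
  let v := Polynomial.C (X 5)
  ![x,
    y,
    s + x ^ 3 * U,
    t + 2 * y ^ 3 * s * U + x ^ 3 * y ^ 3 * U ^ 2,
    u + 3 * y ^ 3 * t * U + 3 * y ^ 6 * s * U ^ 2 + x ^ 3 * y ^ 6 * U ^ 3,
    v + x ^ 2 * y ^ 2 * U]

/-- Values of `θ` on the variables of `B₇ = k[x₁, x₂, x₃, y₁, y₂, y₃, v]`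
(in this order, `x₁ = X 0, …, v = X 6`). -/
def r7Vars (k : Type*) [Field k] : Fin 7 → Polynomial (MvPolynomial (Fin 7) k) :=
  let U : Polynomial (MvPolynomial (Fin 7) k) := Polynomial.X
  let x₁ := Polynomial.C (X 0)
  let x₂ := Polynomial.C (X 1)
  let x₃ := Polynomial.C (X 2)
  let y₁ := Polynomial.C (X 3)
  let y₂ := Polynomial.C (X 4)
  let y₃ := Polynomial.C (X 5)
  let v := Polynomial.C (X 6)
  ![x₁,
    x₂,
    x₃,
    y₁ + x₁ ^ 3 * U,
    y₂ + x₂ ^ 3 * U,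
    y₃ + x₃ ^ 3 * U,
    v + x₁ ^ 2 * x₂ ^ 2 * x₃ ^ 2 * U]

/-- The characteristic-free Daigle–Freudenburg example (DF5). -/
def thetaDF5 (k : Type*) [Field k] : LFIHD k (MvPolynomial (Fin 5) k) :=
  LFIHD.ofVars (df5Vars k)
    (by intro i; fin_cases i <;> simp [df5Vars])
    (by
      intro i
      have e2 : Polynomial.taylor (Polynomial.X : Polynomial (MvPolynomial (Fin 5) k)) 2 = 2 := map_ofNat (Polynomial.taylorAlgHom _) 2
      have e3 : Polynomial.taylor (Polynomial.X : Polynomial (MvPolynomial (Fin 5) k)) 3 = 3 := map_ofNat (Polynomial.taylorAlgHom _) 3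
      have c2 : (Polynomial.C 2 : Polynomial (Polynomial (MvPolynomial (Fin 5) k))) = 2 :=
        map_ofNat Polynomial.C 2
      have c3 : (Polynomial.C 3 : Polynomial (Polynomial (MvPolynomial (Fin 5) k))) = 3 :=
        map_ofNat Polynomial.C 3
      fin_cases i <;>
        simp [df5Vars, Polynomial.taylor_mul, Polynomial.taylor_pow, e2, e3, c2, c3] <;> ring)

/-- The characteristic-free Freudenburg example (F6). -/
def thetaF6 (k : Type*) [Field k] : LFIHD k (MvPolynomial (Fin 6) k) :=
  LFIHD.ofVars (f6Vars k)
    (by intro i; fin_cases i <;> simp [f6Vars])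
    (by
      intro i
      have e2 : Polynomial.taylor (Polynomial.X : Polynomial (MvPolynomial (Fin 6) k)) 2 = 2 := map_ofNat (Polynomial.taylorAlgHom _) 2
      have e3 : Polynomial.taylor (Polynomial.X : Polynomial (MvPolynomial (Fin 6) k)) 3 = 3 := map_ofNat (Polynomial.taylorAlgHom _) 3
      have c2 : (Polynomial.C 2 : Polynomial (Polynomial (MvPolynomial (Fin 6) k))) = 2 :=
        map_ofNat Polynomial.C 2
      have c3 : (Polynomial.C 3 : Polynomial (Polynomial (MvPolynomial (Fin 6) k))) = 3 :=
        map_ofNat Polynomial.C 3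
      fin_cases i <;>
        simp [f6Vars, Polynomial.taylor_mul, Polynomial.taylor_pow, e2, e3, c2, c3] <;> ring)

/-- The characteristic-free Roberts example (R7). -/
def thetaR7 (k : Type*) [Field k] : LFIHD k (MvPolynomial (Fin 7) k) :=
  LFIHD.ofVars (r7Vars k)
    (by intro i; fin_cases i <;> simp [r7Vars])
    (by
      intro i
      fin_cases i <;> simp [r7Vars, Polynomial.taylor_mul, Polynomial.taylor_pow] <;> ring)

end Examples

end

/-!
Each of the three rings is `B = B'[v]` with `θ v = v + aU`, where `B'` is the polynomial ring in the
other variables, stable under `θ`, and `a ∈ B'` is invariant. Three facts give the theorem.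

*Reduction to a monic invariant* (`Subalgebra.fg_of_monic_mem`, `LFIHD.fg_invariants_of_monic`).
The leading coefficient in `v` of an invariant is an invariant of `B'`. Let `A'` be the ring of
invariants of `B'` and `I_d ⊆ A'` the ideal of coefficients of `v ^ d` of invariants of degree at
most `d` in `v`. If some invariant is monic of degree `q > 0` in `v`, then `I_d ⊆ I_{d+q}`, so for
Noetherian `A'` the ideals `I_d` are determined by finitely many of them, and the invariants of `B`
are finitely generated as soon as `A'` is.

*The monic invariant* (`exists_map_eq_add_pow_of_cubic`). This is where characteristic `p` is used.
In each example there is a polynomial `F(W)` over `B'` of degree 3, with leading coefficient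
`z ^ 3`, such that `θ` acts on its coefficients as the translation `W ↦ W + cU`, and `a = z ^ 2 * c`:
the generic binary cubic in DF5 and F6, the product of the `x_i ^ 3 * W + y_i` in R7. For `p ≠ 3` write
`2p = 3m + r` with `r ∈ {1, 2}`. The coefficient `c_j` of `W ^ j` in `F ^ m` is sent by `θ` to
`∑ i, (j + i).choose j * c_{j + i} * (cU) ^ i`, and for `j = p - r` nearly all these binomial
coefficients vanish modulo `p`: the terms left are `c_j`, for `r = 2` the linear term
`-c_{p - 1} * c * U`, where `c_{p - 1}` is invariant, and the top term `z ^ (3m) * (cU) ^ p`. Hence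
`b = z ^ r * c_{p - r}` satisfies `θ b = b + (aU) ^ p - l * a * U` with `l` invariant, and
`v ^ p - l * v - b` is invariant. For `p = 3` such a `b` is written down directly.

*Finite generation of `A'`* (`fixedSubalgebra_fg_of_normalForm`). Explicit invariants generate a
subalgebra `A ⊆ A'`. The element `x` of `A` whose cube is the coefficient of `U` in `θ s`, for one
of the variables `s`, satisfies `A'[1/x] = A[1/x]`, so `A = A'` once `A ∩ xB' = xA`. Modulo `xA`,
the algebra `A` is spanned by normal monomials in the generators, and a substitution with `x ↦ 0`
sends these to nonzero multiples of distinct monomials; so an element of `A` divisible by `x` lies in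
`xA`. In DF5 and F6 the generators are the seminvariants of the binary cubic; in characteristic 2
the Jacobian covariant becomes divisible by `x ^ 3`, and its quotient takes the place of the
Jacobian and the discriminant. In R7 they are the `x_i` and the minors
`x_i ^ 3 * y_j - x_j ^ 3 * y_i`.
-/

/-! ### Subalgebras of a polynomial ring with a monic element -/

section

open Polynomial

/-- A subalgebra `S` of `R[X]` that contains the constants from `A`, has all leading coefficients in
`A` and contains a monic polynomial of positive degree is finitely generated if `A` is. -/
theorem Subalgebra.fg_of_monic_mem {k R : Type*} [CommRing k] [IsNoetherianRing k] [CommRing R]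
    [Algebra k R] {A : Subalgebra k R} (hA : A.FG) {S : Subalgebra k R[X]}
    (hAS : ∀ a ∈ A, C a ∈ S) (hS : ∀ g ∈ S, g.leadingCoeff ∈ A)
    {f : R[X]} (hf : f ∈ S) (hm : f.Monic) (hd : 0 < f.natDegree) : S.FG := by
  classical
  set q := f.natDegree with hq
  have hcoeff : ∀ g ∈ S, ∀ d, g.natDegree ≤ d → g.coeff d ∈ A := by
    intro g hg d hgd
    rcases hgd.eq_or_lt with h | h
    · rw [← h]; exact hS g hg
    · rw [coeff_eq_zero_of_natDegree_lt h]; exact A.zero_mem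
  have : Algebra.FiniteType k A := (Subalgebra.fg_iff_finiteType A).1 hA
  have : IsNoetherianRing A := Algebra.FiniteType.isNoetherianRing k A
  -- `I d` consists of the coefficients of `X ^ d` of the elements of `S` of degree at most `d`.
  let I : ℕ → Ideal A := fun d =>
    { carrier := {a | ∃ g ∈ S, g.natDegree ≤ d ∧ g.coeff d = a}
      add_mem' := by
        rintro a b ⟨g, hg, hgd, hga⟩ ⟨g', hg', hgd', hga'⟩
        exact ⟨g + g', S.add_mem hg hg', natDegree_add_le_of_degree_le hgd hgd', by
          simp [hga, hga']⟩
      zero_mem' := ⟨0, S.zero_mem, by simp, by simp⟩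
      smul_mem' := by
        rintro a b ⟨g, hg, hgd, hga⟩
        exact ⟨C (a : R) * g, S.mul_mem (hAS a a.2) hg,
          (natDegree_C_mul_le _ _).trans hgd, by simp [hga]⟩ }
  have hI : ∀ d, I d ≤ I (d + q) := by
    rintro d a ⟨g, hg, hgd, hga⟩
    refine ⟨g * f, S.mul_mem hg hf, natDegree_mul_le_of_le hgd le_rfl, ?_⟩
    rw [coeff_mul_add_eq_of_natDegree_le hgd le_rfl, hga, hm.coeff_natDegree, mul_one]
  -- The chains `I r ≤ I (r + q) ≤ I (r + 2q) ≤ ⋯` become stationary.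
  obtain ⟨D, hD⟩ : ∃ D, ∀ d, D ≤ d → q ≤ d ∧ I d ≤ I (d - q) := by
    have h1 : ∀ r, ∃ n, ∀ m, n ≤ m → I (r + n * q) = I (r + m * q) := by
      intro r
      exact monotone_stabilizes_iff_noetherian.2 (inferInstance : IsNoetherian A A)
        ⟨fun n => I (r + n * q), monotone_nat_of_le_succ fun n => by
          simpa [add_mul, add_assoc] using hI (r + n * q)⟩
    choose n hn using h1
    -- If `d` is at least this bound, then already `d - q` is in the stationary part of its chain.
    refine ⟨q * ((Finset.range q).sup n + 1), fun d hdd => ?_⟩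
    have hr : d % q < q := Nat.mod_lt _ hd
    have h2 : (Finset.range q).sup n + 1 ≤ d / q := (Nat.le_div_iff_mul_le hd).2 (by linarith)
    have h3 : n (d % q) ≤ (Finset.range q).sup n := Finset.le_sup (f := n) (by simpa using hr)
    have h4 : d % q + d / q * q = d := by rw [mul_comm]; exact Nat.mod_add_div d q
    obtain ⟨e, he⟩ : ∃ e, d / q = e + 1 := ⟨d / q - 1, by omega⟩
    have h5 : d = d % q + e * q + q := by rw [he, add_mul, one_mul] at h4; omega
    refine ⟨by omega, ?_⟩
    have h6 := (hn (d % q) e (by omega)).symm.trans (hn (d % q) (d / q) (by omega))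
    rw [h4, show d % q + e * q = d - q by omega] at h6
    exact h6.ge
  -- Finitely many elements of `S` give all of `I d`.
  have hfin : ∀ d, ∃ P : Finset R[X], (∀ g ∈ P, g ∈ S ∧ g.natDegree ≤ d) ∧
      ∀ a ∈ I d, ∃ g ∈ Algebra.adjoin k ((C '' (A : Set R)) ∪ (P : Set R[X])),
        g ∈ S ∧ g.natDegree ≤ d ∧ g.coeff d = a := by
    intro d
    obtain ⟨s, hs⟩ := (IsNoetherian.noetherian (I d) : (I d).FG)
    have h1 : ∀ a : s, ∃ g ∈ S, g.natDegree ≤ d ∧ g.coeff d = (a : A) := fun a =>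
      (hs ▸ Ideal.subset_span a.2 : (a : A) ∈ I d)
    choose w hwS hwd hwc using h1
    refine ⟨Finset.univ.image w, ?_, ?_⟩
    · intro g hg
      obtain ⟨a, -, rfl⟩ := Finset.mem_image.1 hg
      exact ⟨hwS a, hwd a⟩
    · intro a ha
      rw [← hs] at ha
      induction ha using Submodule.span_induction with
      | mem a ha =>
        exact ⟨w ⟨a, ha⟩, Algebra.subset_adjoin (Or.inr (by simp)), hwS _, hwd _, hwc _⟩
      | zero => exact ⟨0, zero_mem _, zero_mem _, by simp, by simp⟩
      | add a b _ _ iha ihb =>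
        obtain ⟨g, hgT, hgS, hgd, hga⟩ := iha
        obtain ⟨g', hgT', hgS', hgd', hga'⟩ := ihb
        exact ⟨g + g', add_mem hgT hgT', add_mem hgS hgS',
          natDegree_add_le_of_degree_le hgd hgd', by simp [hga, hga']⟩
      | smul a b _ ihb =>
        obtain ⟨g, hgT, hgS, hgd, hga⟩ := ihb
        exact ⟨C (a : R) * g, mul_mem (Algebra.subset_adjoin (Or.inl ⟨a, a.2, rfl⟩)) hgT,
          mul_mem (hAS a a.2) hgS, (natDegree_C_mul_le _ _).trans hgd, by simp [hga]⟩
  choose P hPS hP using hfin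
  obtain ⟨t, ht⟩ := hA
  let G : Finset R[X] := t.image C ∪ ({f} ∪ (Finset.range D).biUnion P)
  refine ⟨G, le_antisymm (Algebra.adjoin_le ?_) ?_⟩
  · intro g hg
    simp only [G, Finset.coe_union, Finset.coe_image, Finset.coe_singleton, Finset.coe_biUnion,
      Set.mem_union, Set.mem_image, Set.mem_singleton_iff, Set.mem_iUnion] at hg
    rcases hg with ⟨a, ha, rfl⟩ | rfl | ⟨d, _, hg⟩
    · exact hAS a (ht ▸ Algebra.subset_adjoin ha)
    · exact hf
    · exact (hPS d g hg).1
  set T := Algebra.adjoin k (G : Set R[X]) with hT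
  have hAT : ∀ a ∈ A, C a ∈ T := by
    have h1 : A ≤ T.comap (CAlgHom : R →ₐ[k] R[X]) := by
      rw [← ht]
      refine Algebra.adjoin_le fun a ha => ?_
      refine Algebra.subset_adjoin ?_
      simp only [G, Finset.coe_union, Finset.coe_image]
      exact Or.inl ⟨a, ha, rfl⟩
    intro a ha
    exact h1 ha
  have hfT : f ∈ T := Algebra.subset_adjoin (by simp [G])
  have hPT : ∀ d < D, Algebra.adjoin k ((C '' (A : Set R)) ∪ (P d : Set R[X])) ≤ T := by
    intro d hdD
    refine Algebra.adjoin_le ?_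
    rintro g (⟨a, ha, rfl⟩ | hg)
    · exact hAT a ha
    · refine Algebra.subset_adjoin ?_
      simp only [G, Finset.coe_union, Finset.coe_biUnion]
      exact Or.inr (Or.inr (Set.mem_biUnion (by simpa using hdD) hg))
  suffices h : ∀ n : ℕ, ∀ g ∈ S, g.degree < n → g ∈ T by
    intro g hg
    exact h (g.natDegree + 1) g hg
      (degree_le_natDegree.trans_lt (by exact_mod_cast Nat.lt_succ_self _))
  intro n
  induction n using Nat.strong_induction_on with
  | _ n ih =>
  intro g hg hgn
  rcases n with _ | d
  · have : g = 0 := by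
      rw [← degree_eq_bot]
      exact Nat.WithBot.lt_zero_iff.1 (by simpa using hgn)
    exact this ▸ T.zero_mem
  have hgd : g.natDegree ≤ d := by
    rw [natDegree_le_iff_coeff_eq_zero]
    exact fun m hm => (degree_lt_iff_coeff_zero _ _).1 hgn m hm
  -- It is enough to find an element of `T` with the same coefficient in degree `d`.
  have key : ∀ g' ∈ S, g' ∈ T → g'.natDegree ≤ d → g'.coeff d = g.coeff d → g ∈ T := by
    intro g' hg'S hg'T hg'd h
    have h1 : g - g' ∈ T := by
      refine ih d (Nat.lt_succ_self d) _ (sub_mem hg hg'S) ?_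
      rw [degree_lt_iff_coeff_zero]
      intro m hdm
      rcases hdm.eq_or_lt with rfl | hlt
      · simp [h]
      · rw [coeff_sub, coeff_eq_zero_of_natDegree_lt (hgd.trans_lt hlt),
          coeff_eq_zero_of_natDegree_lt (hg'd.trans_lt hlt), sub_zero]
    simpa using add_mem h1 hg'T
  have hgI : (⟨g.coeff d, hcoeff g hg d hgd⟩ : A) ∈ I d := ⟨g, hg, hgd, rfl⟩
  rcases lt_or_ge d D with hdD | hdD
  · obtain ⟨g', hg'T, hg'S, hg'd, h⟩ := hP d _ hgI
    exact key g' hg'S (hPT d hdD hg'T) hg'd h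
  · -- Here `I d ≤ I (d - q)`, so a multiple of `f` has the same coefficient.
    obtain ⟨hqd, hle⟩ := hD d hdD
    obtain ⟨g', hg'S, hg'd, h⟩ := hle hgI
    have hg'T : g' ∈ T := by
      refine ih (d - q + 1) (by omega) g' hg'S ?_
      exact (natDegree_le_iff_degree_le.1 hg'd).trans_lt (by exact_mod_cast Nat.lt_succ_self _)
    refine key (g' * f) (mul_mem hg'S hf) (mul_mem hg'T hfT) ?_ ?_
    · exact (natDegree_mul_le_of_le hg'd le_rfl).trans (by omega)
    · rw [show d = (d - q) + q by omega, coeff_mul_add_eq_of_natDegree_le hg'd le_rfl, h,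
        hm.coeff_natDegree, mul_one]
      rw [show d - q + q = d by omega]

end

/-! ### Adjoining a variable to a ring with a higher derivation -/

namespace LFIHD

open Polynomial

/-- The ring of invariants `{b | θ b = b}` of an algebra homomorphism `θ : B → B[U]`. -/
noncomputable def fixedSubalgebra {k B : Type*} [Field k] [CommRing B] [Algebra k B]
    (θ : B →ₐ[k] B[X]) : Subalgebra k B :=
  AlgHom.equalizer θ CAlgHom

theorem mem_fixedSubalgebra {k B : Type*} [Field k] [CommRing B] [Algebra k B]
    {θ : B →ₐ[k] B[X]} {b : B} : b ∈ fixedSubalgebra θ ↔ θ b = C b :=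
  Iff.rfl

theorem invariants_eq_fixedSubalgebra {k B : Type*} [Field k] [CommRing B] [Algebra k B]
    (θ : LFIHD k B) : θ.invariants = fixedSubalgebra θ.toAlgHom := by
  ext b
  rw [mem_fixedSubalgebra]
  constructor
  · intro h
    ext n
    rcases n with _ | n
    · rw [θ.coeff_zero, coeff_C_zero]
    · rw [coeff_C_succ]
      exact h (n + 1) (by omega)
  · intro h n hn
    change (θ.toAlgHom b).coeff n = 0
    rw [h, coeff_C, if_neg (by omega)]

/-- `k[X₀, …, Xₙ]` as the ring of polynomials in `Xₙ` over `k[X₀, …, Xₙ₋₁]`. -/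
noncomputable def lastVarEquiv (k : Type*) [Field k] (n : ℕ) :
    MvPolynomial (Fin (n + 1)) k ≃ₐ[k] (MvPolynomial (Fin n) k)[X] :=
  AlgEquiv.ofAlgHom
    (MvPolynomial.aeval
      (Fin.snoc (α := fun _ => (MvPolynomial (Fin n) k)[X]) (fun i => C (MvPolynomial.X i)) X))
    (aevalTower (MvPolynomial.rename Fin.castSucc) (MvPolynomial.X (Fin.last n)))
    (by
      refine Polynomial.algHom_ext' (MvPolynomial.algHom_ext fun i => ?_) ?_
      · simp [CAlgHom]
      · simp)
    (by
      refine MvPolynomial.algHom_ext fun i => ?_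
      induction i using Fin.lastCases with
      | last => simp
      | cast i => simp)

theorem lastVarEquiv_last (k : Type*) [Field k] (n : ℕ) :
    lastVarEquiv k n (MvPolynomial.X (Fin.last n)) = X := by
  simp [lastVarEquiv]

theorem lastVarEquiv_rename (k : Type*) [Field k] (n : ℕ) (b : MvPolynomial (Fin n) k) :
    lastVarEquiv k n (MvPolynomial.rename Fin.castSucc b) = C b := by
  have h : (lastVarEquiv k n).toAlgHom.comp (MvPolynomial.rename Fin.castSucc) =
      (CAlgHom : MvPolynomial (Fin n) k →ₐ[k] _) :=
    MvPolynomial.algHom_ext fun i => by simp [lastVarEquiv, CAlgHom]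
  exact DFunLike.congr_fun h b

/-- If `θ` extends a homomorphism on `k[X₀, …, Xₙ₋₁]` with finitely generated fixed ring, and
`θ Xₙ = Xₙ + aU`, then a pair `l, b` as below makes `Xₙ ^ p - l * Xₙ - b` an invariant that is monic
in `Xₙ`, and the invariants of `θ` are finitely generated. -/
theorem fg_invariants_of_monic {k : Type*} [Field k] {n p : ℕ} [Fact p.Prime] [CharP k p]
    (g : Fin n → (MvPolynomial (Fin n) k)[X]) (a : MvPolynomial (Fin n) k)
    (θ : LFIHD k (MvPolynomial (Fin (n + 1)) k))
    (hθ : ∀ i, θ.toAlgHom (MvPolynomial.X (Fin.castSucc i)) =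
      (g i).map (MvPolynomial.rename Fin.castSucc : _ →ₐ[k] MvPolynomial (Fin (n + 1)) k).toRingHom)
    (hv : θ.toAlgHom (MvPolynomial.X (Fin.last n)) =
      C (MvPolynomial.X (Fin.last n)) + C (MvPolynomial.rename Fin.castSucc a) * X)
    (hA : (fixedSubalgebra (MvPolynomial.aeval g)).FG)
    (l b : MvPolynomial (Fin n) k)
    (hl : MvPolynomial.aeval g l = C l)
    (hb : MvPolynomial.aeval g b = C b + C (a ^ p) * X ^ p - C (l * a) * X) :
    θ.invariants.FG := by
  have hp : p.Prime := Fact.out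
  rw [invariants_eq_fixedSubalgebra]
  set ι : MvPolynomial (Fin n) k →ₐ[k] MvPolynomial (Fin (n + 1)) k :=
    MvPolynomial.rename Fin.castSucc with hι
  have hιinj : Function.Injective ι :=
    MvPolynomial.rename_injective _ (Fin.castSucc_injective n)
  set e := lastVarEquiv k n with he
  set θ' : MvPolynomial (Fin n) k →ₐ[k] _ := MvPolynomial.aeval g with hθ'
  have hres : ∀ c, θ.toAlgHom (ι c) = (θ' c).map ι.toRingHom := by
    have h : θ.toAlgHom.comp ι = (mapAlgHom ι).comp θ' :=
      MvPolynomial.algHom_ext fun i => by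
        simp only [AlgHom.comp_apply, hι, MvPolynomial.rename_X, hθ, hθ', MvPolynomial.aeval_X]
        rfl
    exact fun c => DFunLike.congr_fun h c
  have hθ'inj : Function.Injective θ' := by
    refine (injective_iff_map_eq_zero θ').2 fun c hc => hιinj ?_
    rw [← θ.coeff_zero (ι c), hres, hc]
    simp
  have hfixed : ∀ c ∈ fixedSubalgebra θ', ι c ∈ fixedSubalgebra θ.toAlgHom := by
    intro c hc
    rw [mem_fixedSubalgebra] at hc ⊢
    rw [hres, hc, map_C]
    rfl
  refine Subalgebra.fg_of_fg_map _ e.toAlgHom e.injective ?_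
  -- `ξ` moves the last variable outside `U`, so that `θ` turns into `Ψ`, the map acting by `θ'` on
  -- the coefficients and translating the last variable. A translation preserves leading
  -- coefficients.
  let Ψ : (MvPolynomial (Fin n) k)[X] →ₐ[k] (MvPolynomial (Fin n) k)[X][X] :=
    aevalTower (CAlgHom.comp θ') (X + C (C a * X))
  let ξ : (MvPolynomial (Fin (n + 1)) k)[X] →ₐ[k] (MvPolynomial (Fin n) k)[X][X] :=
    aevalTower (A' := (MvPolynomial (Fin n) k)[X][X]) ((mapAlgHom CAlgHom).comp e.toAlgHom) (C X)
  have hξC : ∀ c, ξ (C c) = (e c).map C := by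
    intro c
    simp only [ξ, aevalTower_C]
    rfl
  have hξX : ξ X = C X := aevalTower_X _ _
  have hΨC : ∀ c, Ψ (C c) = C (θ' c) := by
    intro c
    simp only [Ψ, aevalTower_C]
    rfl
  have hΨX : Ψ X = X + C (C a * X) := aevalTower_X _ _
  have hξι : ξ.comp (mapAlgHom ι) = CAlgHom := by
    refine Polynomial.algHom_ext' (AlgHom.ext fun c => ?_) ?_
    · change ξ ((C c).map ι.toRingHom) = C (C c)
      rw [map_C, hξC]
      change (e (ι c)).map C = C (C c)
      rw [he, hι, lastVarEquiv_rename, map_C]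
    · change ξ ((X : (MvPolynomial (Fin n) k)[X]).map ι.toRingHom) = C X
      rw [map_X, hξX]
  have hΨ : ∀ f, ξ (θ.toAlgHom f) = Ψ (e f) := by
    have h : ξ.comp θ.toAlgHom = Ψ.comp e.toAlgHom := by
      refine MvPolynomial.algHom_ext fun i => ?_
      change ξ (θ.toAlgHom _) = Ψ (e _)
      induction i using Fin.lastCases with
      | last =>
        rw [hv, map_add, map_mul, hξC, hξC, hξX, he, lastVarEquiv_last, hΨX, hι,
          lastVarEquiv_rename]
        simp
      | cast i =>
        have h1 : e (MvPolynomial.X (Fin.castSucc i)) = C (MvPolynomial.X i) := by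
          rw [he, ← lastVarEquiv_rename, MvPolynomial.rename_X]
        rw [hθ, h1, hΨC, hθ', MvPolynomial.aeval_X]
        exact DFunLike.congr_fun hξι (g i)
    exact fun f => DFunLike.congr_fun h f
  -- The monic invariant.
  let f : (MvPolynomial (Fin n) k)[X] := X ^ p - (C l * X + C b)
  have hdeg : (C l * X + C b).degree < (p : WithBot ℕ) :=
    degree_linear_le.trans_lt (by exact_mod_cast hp.one_lt)
  have hfdeg : f.natDegree = p := by
    rw [natDegree_sub_eq_left_of_natDegree_lt, natDegree_X_pow]
    rw [natDegree_X_pow]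
    exact (natDegree_linear_le).trans_lt hp.one_lt
  refine Subalgebra.fg_of_monic_mem hA (f := f) ?_ ?_ ?_ (monic_X_pow_sub hdeg)
    (hfdeg ▸ hp.pos)
  · intro c hc
    exact ⟨ι c, hfixed c hc, lastVarEquiv_rename k n c⟩
  · rintro _ ⟨c, hc, rfl⟩
    change (e c).leadingCoeff ∈ _
    have h1 : (e c).map C = Ψ (e c) := by
      rw [← hΨ, mem_fixedSubalgebra.1 hc, hξC]
    have h2 : Ψ (e c) = taylor (C a * X) ((e c).map θ'.toRingHom) := by
      rw [taylor_apply, comp, eval₂_map]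
      rfl
    have h3 : ((e c).map θ'.toRingHom).natDegree = (e c).natDegree :=
      natDegree_map_eq_of_injective hθ'inj _
    rw [mem_fixedSubalgebra]
    have h4 := congrArg (fun P => P.coeff (e c).natDegree) (h1.trans h2)
    simp only [coeff_map] at h4
    rw [← h3, coeff_taylor_natDegree, leadingCoeff, h3, coeff_map] at h4
    exact h4.symm
  · refine ⟨MvPolynomial.X (Fin.last n) ^ p - (ι l * MvPolynomial.X (Fin.last n) + ι b), ?_, ?_⟩
    · change _ = _
      change θ.toAlgHom _ = C _
      have : CharP (MvPolynomial (Fin (n + 1)) k)[X] p :=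
        charP_of_injective_algebraMap' k p
      have hl' : θ.toAlgHom (ι l) = C (ι l) := hfixed l hl
      have hb' : θ.toAlgHom (ι b) = C (ι b) + C (ι a ^ p) * X ^ p - C (ι l * ι a) * X := by
        rw [hres, hb]
        simp
      rw [map_sub, map_add, map_mul, map_pow, hv, hl', hb', add_pow_char]
      simp only [map_sub, map_add, map_mul, map_pow]
      ring
    · change e _ = f
      simp only [f, map_sub, map_add, map_mul, map_pow, he, hι, lastVarEquiv_rename,
        lastVarEquiv_last]

end LFIHD

/-! ### Elements translated by a `p`-th power -/

section

open Polynomial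

theorem Polynomial.coeff_taylor_eq_sum {R : Type*} [CommRing R] (f : R[X]) (r : R) (j N : ℕ)
    (hf : f.natDegree ≤ j + N) :
    (taylor r f).coeff j =
      ∑ i ∈ Finset.range (N + 1), ((j + i).choose j : R) * f.coeff (j + i) * r ^ i := by
  have h : (hasseDeriv j f).natDegree < N + 1 := by
    rw [Nat.lt_succ_iff, natDegree_le_iff_coeff_eq_zero]
    intro i hi
    rw [hasseDeriv_coeff, coeff_eq_zero_of_natDegree_lt (hf.trans_lt (by omega)), mul_zero]
  rw [taylor_coeff, eval_eq_sum_range' h]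
  refine Finset.sum_congr rfl fun i _ => ?_
  rw [hasseDeriv_coeff, add_comm i j]

/-- Let `θ` act on the coefficients of a cubic `F` with leading coefficient `z ^ 3` as the
translation `W ↦ W + cU`. Then, in characteristic `p ≠ 3`, there are an invariant `l` and an
element `b` moved by `(z ^ 2 * c * U) ^ p - l * z ^ 2 * c * U`; both are, up to a power of `z`,
coefficients of a power of `F`. -/
theorem exists_map_eq_add_pow_of_cubic {B : Type*} [CommRing B] {p : ℕ} [hp : Fact p.Prime]
    [CharP B p]
    (hp3 : p ≠ 3) (θ : B →+* B[X]) {z c : B} (hz : θ z = C z) {F : B[X]}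
    (hF : F.natDegree ≤ 3) (hF3 : F.coeff 3 = z ^ 3)
    (hθ : F.map θ = taylor (C c * X) (F.map C)) :
    ∃ l b : B, θ l = C l ∧
      θ b = C b + C ((z ^ 2 * c) ^ p) * X ^ p - C (l * (z ^ 2 * c)) * X := by
  have hpp : p.Prime := hp.out
  have hp2 := hpp.two_le
  have hmod : p % 3 ≠ 0 := fun h =>
    hp3 ((Nat.prime_dvd_prime_iff_eq Nat.prime_three hpp).1 (Nat.dvd_of_mod_eq_zero h)).symm
  have key : ∀ m j N, 3 * m = j + N → θ ((F ^ m).coeff j) =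
      ∑ i ∈ Finset.range (N + 1),
        ((j + i).choose j : B[X]) * C ((F ^ m).coeff (j + i) * c ^ i) * X ^ i := by
    intro m j N hm
    have h1 : (F ^ m).map θ = taylor (C c * X) ((F ^ m).map C) := by
      rw [Polynomial.map_pow, hθ, Polynomial.map_pow, taylor_pow]
    have h2 := congrArg (fun P => P.coeff j) h1
    simp only [coeff_map] at h2
    rw [h2, coeff_taylor_eq_sum _ _ j N]
    · refine Finset.sum_congr rfl fun i _ => ?_
      rw [coeff_map, mul_pow, C_mul, C_pow]
      ring
    · exact natDegree_map_le.trans (natDegree_pow_le.trans (by nlinarith))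
  have htop : ∀ m, (F ^ m).coeff (3 * m) = (z ^ m) ^ 3 := by
    intro m
    rw [mul_comm, coeff_pow_of_natDegree_le hF, hF3]
    ring
  have hcast : ∀ n : ℕ, p ∣ n → (n : B[X]) = 0 := fun n h => (CharP.cast_eq_zero_iff B[X] p n).2 h
  -- Adding `j` and `i` in base `p` produces a carry.
  have hvanish : ∀ j i, j < p → i < p → p ≤ j + i → (((j + i).choose j : ℕ) : B[X]) = 0 :=
    fun j i hj hi hji => hcast _ (hpp.dvd_choose_add hj hi hji)
  have hone : ∀ j, j < p → (((j + p).choose j : ℕ) : B[X]) = 1 := by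
    intro j hj
    have h := Choose.choose_modEq_choose_mod_mul_choose_div_nat (n := j + p) (k := j) (p := p)
    rw [Nat.add_mod_right, Nat.mod_eq_of_lt hj, Nat.choose_self, Nat.div_eq_of_lt hj,
      Nat.choose_zero_right, mul_one] at h
    exact_mod_cast (CharP.natCast_eq_natCast B[X] p).2 h
  obtain h3 | h3 : p % 3 = 1 ∨ p % 3 = 2 := by omega
  · -- `b` is `z ^ 2` times the coefficient of `W ^ (p - 2)`; the terms `i = 0, 1, p` survive.
    obtain ⟨m, hm⟩ : ∃ m, 3 * m + 2 = 2 * p := ⟨(2 * p - 2) / 3, by omega⟩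
    have hp4 : 4 ≤ p := by omega
    refine ⟨(F ^ m).coeff (p - 1), z ^ 2 * (F ^ m).coeff (p - 2), ?_, ?_⟩
    · rw [key m (p - 1) (p - 1) (by omega), Finset.sum_range_succ', Finset.sum_eq_zero]
      · simp
      · intro i hi
        rw [Finset.mem_range] at hi
        rw [hvanish _ _ (by omega) (by omega) (by omega), zero_mul, zero_mul]
    · have h4 : ((p - 2 + 1).choose (p - 2) : B[X]) = -1 := by
        rw [Nat.choose_succ_self_right, eq_neg_iff_add_eq_zero]
        have := hcast p dvd_rfl
        rw [← this]
        exact_mod_cast congrArg _ (by omega : p - 2 + 1 + 1 = p)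
      rw [map_mul, map_pow, hz, key m (p - 2) p (by omega), Finset.sum_range_succ,
        show p = (p - 2) + 1 + 1 by omega, Finset.sum_range_succ', Finset.sum_range_succ',
        ← show p = (p - 2) + 1 + 1 by omega, Finset.sum_eq_zero]
      · rw [hone _ (by omega), h4, show p - 2 + (0 + 1) = p - 1 by omega,
          show p - 2 + p = 3 * m by omega, htop, show p - 2 + 0 = p - 2 from rfl, Nat.choose_self]
        have h5 : (z ^ 2 * c) ^ p = z ^ 2 * ((z ^ m) ^ 3 * c ^ p) := by
          rw [mul_pow, ← pow_mul, ← hm]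
          ring
        rw [h5]
        simp only [C_mul, C_pow]
        push_cast
        ring
      · intro i hi
        rw [Finset.mem_range] at hi
        rw [hvanish _ _ (by omega) (by omega) (by omega), zero_mul, zero_mul]
  · -- `b` is `z` times the coefficient of `W ^ (p - 1)`; the terms `i = 0, p` survive.
    obtain ⟨m, hm⟩ : ∃ m, 3 * m + 1 = 2 * p := ⟨(2 * p - 1) / 3, by omega⟩
    refine ⟨0, z * (F ^ m).coeff (p - 1), by simp, ?_⟩
    rw [map_mul, hz, key m (p - 1) p (by omega), Finset.sum_range_succ,
      show p = (p - 1) + 1 by omega, Finset.sum_range_succ',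
      ← show p = (p - 1) + 1 by omega, Finset.sum_eq_zero]
    · rw [hone _ (by omega), show p - 1 + p = 3 * m by omega, htop, Nat.add_zero,
        Nat.choose_self]
      have h5 : (z ^ 2 * c) ^ p = z * ((z ^ m) ^ 3 * c ^ p) := by
        rw [mul_pow, ← pow_mul, ← hm]
        ring
      rw [h5]
      simp only [C_mul, C_pow]
      push_cast
      simp
      ring
    · intro i hi
      rw [Finset.mem_range] at hi
      rw [hvanish _ _ (by omega) (by omega) (by omega), zero_mul, zero_mul]

end

/-! ### A criterion for generators of the fixed ring -/

section

open MvPolynomial LFIHD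

theorem MvPolynomial.linearIndependent_of_eq_monomial {k τ N : Type*} [Field k] [Fintype τ]
    {w : N → MvPolynomial τ k} (r : N → k) (e : N → τ → ℕ) (hr : ∀ n, r n ≠ 0)
    (he : Function.Injective e) (hw : ∀ n, w n = C (r n) * ∏ j, X j ^ e n j) :
    LinearIndependent k w := by
  have h1 : LinearIndependent k
      (fun n => monomial (Finsupp.equivFunOnFinite.symm (e n)) (1 : k)) := by
    have h := (basisMonomials τ k).linearIndependent.comp _
      (Finsupp.equivFunOnFinite.symm.injective.comp he)
    simpa [Function.comp_def] using h
  have h2 := h1.units_smul (fun n => Units.mk0 (r n) (hr n))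
  convert h2 using 1
  funext n
  rw [hw, Pi.smul_apply', Units.smul_mk0, smul_monomial, smul_eq_mul, mul_one, monomial_eq,
    Finsupp.prod_fintype _ _ (fun _ => pow_zero _)]
  rfl

/-- If `L` is nonconstant and each variable is sent by `θ`, up to a power of `x`, into `A` modulo
`L`, then every element fixed by `θ` lies in `A[1/x]`: it differs from an element of `A`, up to a
power of `x`, by a constant divisible by `L`. For `L = x ^ 3 * U + s` this is the evaluation of `θ`
at `U = -s / x ^ 3`, without localizing. -/
theorem exists_pow_mul_mem_of_dvd {k τ : Type*} [Field k]
    {θ : MvPolynomial τ k →ₐ[k] Polynomial (MvPolynomial τ k)}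
    {A : Subalgebra k (MvPolynomial τ k)} {x : MvPolynomial τ k} (hx : x ∈ A)
    {L : Polynomial (MvPolynomial τ k)} (hL : 0 < L.natDegree)
    (h : ∀ j, ∃ N : ℕ, ∃ c ∈ A, L ∣ Polynomial.C (x ^ N) * θ (X j) - Polynomial.C c)
    {b : MvPolynomial τ k} (hb : b ∈ fixedSubalgebra θ) : ∃ N : ℕ, x ^ N * b ∈ A := by
  have key : ∀ b, ∃ N : ℕ, ∃ c ∈ A, L ∣ Polynomial.C (x ^ N) * θ b - Polynomial.C c := by
    intro b
    induction b using MvPolynomial.induction_on with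
    | C a =>
      refine ⟨0, C a, A.algebraMap_mem a, ?_⟩
      have h1 : θ (C a) = Polynomial.C (C a) := θ.commutes a
      simp [h1]
    | add p q hp hq =>
      obtain ⟨N, c, hc, u, hu⟩ := hp
      obtain ⟨N', c', hc', u', hu'⟩ := hq
      refine ⟨N + N', x ^ N' * c + x ^ N * c',
        A.add_mem (A.mul_mem (A.pow_mem hx _) hc) (A.mul_mem (A.pow_mem hx _) hc'),
        Polynomial.C (x ^ N') * u + Polynomial.C (x ^ N) * u', ?_⟩
      simp only [map_add, map_mul, pow_add]
      linear_combination Polynomial.C (x ^ N') * hu + Polynomial.C (x ^ N) * hu'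
    | mul_X p j hp =>
      obtain ⟨N, c, hc, u, hu⟩ := hp
      obtain ⟨N', c', hc', u', hu'⟩ := h j
      refine ⟨N + N', c * c', A.mul_mem hc hc',
        u * Polynomial.C (x ^ N') * θ (X j) + Polynomial.C c * u', ?_⟩
      simp only [map_mul, pow_add]
      linear_combination Polynomial.C (x ^ N') * θ (X j) * hu + Polynomial.C c * hu'
  obtain ⟨N, c, hc, hdvd⟩ := key b
  rw [mem_fixedSubalgebra.1 hb, ← map_mul, ← map_sub] at hdvd
  have h0 : x ^ N * b - c = 0 := by
    by_contra hne
    have h1 := Polynomial.natDegree_le_of_dvd hdvd (Polynomial.C_ne_zero.2 hne)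
    rw [Polynomial.natDegree_C] at h1
    omega
  exact ⟨N, by rwa [sub_eq_zero.1 h0]⟩

/-- Criterion for the invariants `G i` to generate the fixed ring of `θ`. The first group of
hypotheses (`hL`, `hgen`) says that they do so after inverting `x = G i₀`. The second group says
that modulo multiples of `x` their monomials reduce to linear combinations of the elements `w n`
(`hspan`; only monomials without `x` have to be considered), and that a homomorphism `ε` killing `x`
sends the `w n` to nonzero multiples of distinct monomials. -/
theorem fixedSubalgebra_fg_of_normalForm {k τ ι N : Type*} [Field k] [Fintype τ] [Fintype ι]
    {θ : MvPolynomial τ k →ₐ[k] Polynomial (MvPolynomial τ k)}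
    {G : ι → MvPolynomial τ k} (hG : ∀ i, θ (G i) = Polynomial.C (G i))
    {i₀ : ι} (h0 : G i₀ ≠ 0)
    {L : Polynomial (MvPolynomial τ k)} (hL : 0 < L.natDegree)
    (hgen : ∀ j, ∃ n : ℕ, ∃ c ∈ Algebra.adjoin k (Set.range G),
      L ∣ Polynomial.C (G i₀ ^ n) * θ (X j) - Polynomial.C c)
    (w : N → MvPolynomial τ k)
    (hspan : ∀ M : Submodule k (MvPolynomial τ k), (∀ n, w n ∈ M) →
      (∀ m : ι → ℕ, G i₀ * ∏ i, G i ^ m i ∈ M) → ∀ m : ι → ℕ, m i₀ = 0 → ∏ i, G i ^ m i ∈ M)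
    (ε : MvPolynomial τ k →ₐ[k] MvPolynomial τ k) (hε : ε (G i₀) = 0)
    (r : N → k) (e : N → τ → ℕ) (hr : ∀ n, r n ≠ 0) (he : Function.Injective e)
    (hεw : ∀ n, ε (w n) = C (r n) * ∏ j, X j ^ e n j) :
    (fixedSubalgebra θ).FG := by
  classical
  set A := Algebra.adjoin k (Set.range G) with hA
  have hGA : ∀ i, G i ∈ A := fun i => Algebra.subset_adjoin ⟨i, rfl⟩
  have hind : LinearIndependent k (fun n => ε (w n)) :=
    linearIndependent_of_eq_monomial r e hr he hεw
  have hle : A ≤ fixedSubalgebra θ :=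
    Algebra.adjoin_le (by rintro _ ⟨i, rfl⟩; exact hG i)
  -- `A` is the span of the `w n` plus `x A`.
  have hdecomp : ∀ c ∈ A, ∃ s ∈ Submodule.span k (Set.range w), ∃ d ∈ A, c = s + G i₀ * d := by
    intro c hc
    let M : Submodule k (MvPolynomial τ k) := Submodule.span k (Set.range w) ⊔
      (Subalgebra.toSubmodule A).map (LinearMap.mulLeft k (G i₀))
    have hmon : ∀ m : ι → ℕ, ∏ i, G i ^ m i ∈ M := by
      have hx : ∀ m : ι → ℕ, G i₀ * ∏ i, G i ^ m i ∈ M := fun m =>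
        Submodule.mem_sup_right ⟨_, A.prod_mem fun i _ => A.pow_mem (hGA i) _, rfl⟩
      intro m
      rcases hm : m i₀ with _ | n
      · exact hspan M (fun n => Submodule.mem_sup_left (Submodule.subset_span ⟨n, rfl⟩)) hx m hm
      · have h1 : ∏ i, G i ^ m i = G i₀ * ∏ i, G i ^ Function.update m i₀ n i := by
          rw [← Finset.mul_prod_erase _ _ (Finset.mem_univ i₀),
            ← Finset.mul_prod_erase _ (fun i => G i ^ Function.update m i₀ n i)
              (Finset.mem_univ i₀), hm, Function.update_self, pow_succ', mul_assoc]
          congr 2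
          refine Finset.prod_congr rfl fun i hi => ?_
          rw [Function.update_of_ne (Finset.ne_of_mem_erase hi)]
        rw [h1]
        exact hx _
    have hcM : c ∈ M := by
      rw [hA, Algebra.adjoin_range_eq_range_aeval] at hc
      obtain ⟨P, rfl⟩ := hc
      change aeval G P ∈ M
      rw [P.as_sum, map_sum]
      refine M.sum_mem fun m _ => ?_
      rw [aeval_monomial, Finsupp.prod_fintype _ _ (fun _ => pow_zero _), ← Algebra.smul_def]
      exact M.smul_mem _ (hmon m)
    obtain ⟨s, hs, _, ⟨d, hd, rfl⟩, rfl⟩ := Submodule.mem_sup.1 hcM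
    exact ⟨s, hs, d, hd, rfl⟩
  -- `A ∩ x B = x A`: applying `ε` to an element divisible by `x` kills its normal form.
  have hdiv : ∀ b, G i₀ * b ∈ A → b ∈ A := by
    intro b hb
    obtain ⟨s, hs, d, hd, hsd⟩ := hdecomp _ hb
    have hs0 : s = 0 := by
      have h1 : ε s = 0 := by
        have h2 := congrArg ε hsd
        simpa [hε] using h2.symm
      obtain ⟨l, rfl⟩ := Finsupp.mem_span_range_iff_exists_finsupp.1 hs
      have h3 : Finsupp.linearCombination k (fun n => ε (w n)) l = 0 := by
        rw [← h1, Finsupp.linearCombination_apply, Finsupp.sum, Finsupp.sum, map_sum]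
        simp
      rw [linearIndependent_iff.1 hind l h3, Finsupp.sum_zero_index]
    rw [hs0, zero_add] at hsd
    rwa [mul_left_cancel₀ h0 hsd]
  have hpow : ∀ n : ℕ, ∀ b, G i₀ ^ n * b ∈ A → b ∈ A := by
    intro n
    induction n with
    | zero => intro b hb; simpa using hb
    | succ n ih => exact fun b hb => ih b (hdiv _ (by rwa [← mul_assoc, ← pow_succ']))
  have : fixedSubalgebra θ = A := by
    refine le_antisymm (fun b hb => ?_) hle
    obtain ⟨n, hn⟩ := exists_pow_mul_mem_of_dvd (hGA i₀) hL hgen hb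
    exact hpow n b hn
  rw [this]
  exact ⟨Finset.univ.image G, by simp [hA]⟩

end

/-! ### Seminvariants of the binary cubic -/

section BinaryCubic

variable {B : Type*} [CommRing B]

/-- The leading coefficient of the Hessian of the binary cubic with coefficients
`x ^ 3, s, t, u`, twisted by powers of `y`; the untwisted form is the case `y = 1`. -/
def cubicHessian (x y s t : B) : B := x ^ 3 * t - y ^ 3 * s ^ 2

/-- The leading coefficient of the Jacobian covariant of the binary cubic with coefficients
`x ^ 3, s, t, u`, twisted by powers of `y`. -/
def cubicJacobian (x y s t u : B) : B :=
  x ^ 6 * u - 3 * x ^ 3 * y ^ 3 * s * t + 2 * y ^ 6 * s ^ 3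

/-- The discriminant, up to a constant factor, of the binary cubic with coefficients
`x ^ 3, s, t, u` (with respect to the monomials multiplied by `1, 3, 3, 1`), twisted by powers of
`y`. -/
def cubicDiscr (x y s t u : B) : B :=
  x ^ 6 * u ^ 2 + 4 * x ^ 3 * y ^ 3 * t ^ 3 - 3 * y ^ 6 * s ^ 2 * t ^ 2 -
    6 * x ^ 3 * y ^ 3 * s * t * u + 4 * y ^ 6 * s ^ 3 * u

/-- In characteristic 2, `cubicJacobian` divided by `x ^ 3`. -/
def cubicHalfJacobian (x y s t u : B) : B := x ^ 3 * u + y ^ 3 * s * t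

theorem cubicJacobian_sq (x y s t u : B) :
    cubicJacobian x y s t u ^ 2 =
      x ^ 6 * cubicDiscr x y s t u - 4 * y ^ 3 * cubicHessian x y s t ^ 3 := by
  simp only [cubicJacobian, cubicDiscr, cubicHessian]
  ring

open Polynomial

/-- `θ` acts on `x, y, s, t, u` as in the example F6; with `y = 1`, as in DF5. -/
structure IsCubicFlow (θ : B →+* B[X]) (x y s t u : B) : Prop where
  map_x : θ x = C x
  map_y : θ y = C y
  map_s : θ s = C s + C x ^ 3 * X
  map_t : θ t = C t + 2 * C y ^ 3 * C s * X + C x ^ 3 * C y ^ 3 * X ^ 2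
  map_u : θ u = C u + 3 * C y ^ 3 * C t * X + 3 * C y ^ 6 * C s * X ^ 2 +
    C x ^ 3 * C y ^ 6 * X ^ 3

namespace IsCubicFlow

variable {θ : B →+* B[X]} {x y s t u : B}

theorem map_hessian (h : IsCubicFlow θ x y s t u) :
    θ (cubicHessian x y s t) = C (cubicHessian x y s t) := by
  simp only [cubicHessian, map_sub, map_mul, map_pow, h.map_x, h.map_y, h.map_s, h.map_t]
  ring

theorem map_jacobian (h : IsCubicFlow θ x y s t u) :
    θ (cubicJacobian x y s t u) = C (cubicJacobian x y s t u) := by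
  simp only [cubicJacobian, map_sub, map_add, map_mul, map_pow, map_ofNat, h.map_x, h.map_y,
    h.map_s, h.map_t, h.map_u]
  ring

theorem map_discr (h : IsCubicFlow θ x y s t u) :
    θ (cubicDiscr x y s t u) = C (cubicDiscr x y s t u) := by
  simp only [cubicDiscr, map_sub, map_add, map_mul, map_pow, map_ofNat, h.map_x, h.map_y,
    h.map_s, h.map_t, h.map_u]
  ring

theorem map_halfJacobian (h : IsCubicFlow θ x y s t u) (h2 : (2 : B[X]) = 0) :
    θ (cubicHalfJacobian x y s t u) = C (cubicHalfJacobian x y s t u) := by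
  simp only [cubicHalfJacobian, map_add, map_mul, map_pow, h.map_x, h.map_y,
    h.map_s, h.map_t, h.map_u]
  linear_combination (2 * C x ^ 3 * C y ^ 3 * C t * X + 3 * C x ^ 3 * C y ^ 6 * C s * X ^ 2 +
    C x ^ 6 * C y ^ 6 * X ^ 3 + C y ^ 6 * C s ^ 2 * X) * h2

theorem dvd_x (h : IsCubicFlow θ x y s t u) :
    C x ^ 3 * X + C s ∣ C (x ^ 0) * θ x - C x :=
  ⟨0, by simp [h.map_x]⟩

theorem dvd_y (h : IsCubicFlow θ x y s t u) :
    C x ^ 3 * X + C s ∣ C (x ^ 0) * θ y - C y :=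
  ⟨0, by simp [h.map_y]⟩

theorem dvd_s (h : IsCubicFlow θ x y s t u) :
    C x ^ 3 * X + C s ∣ C (x ^ 0) * θ s - C 0 :=
  ⟨1, by simp [h.map_s, add_comm]⟩

theorem dvd_t (h : IsCubicFlow θ x y s t u) :
    C x ^ 3 * X + C s ∣ C (x ^ 3) * θ t - C (cubicHessian x y s t) := by
  refine ⟨C y ^ 3 * (C x ^ 3 * X + C s), ?_⟩
  simp only [cubicHessian, map_sub, map_mul, map_pow, h.map_t]
  ring

theorem dvd_u (h : IsCubicFlow θ x y s t u) :
    C x ^ 3 * X + C s ∣ C (x ^ 6) * θ u - C (cubicJacobian x y s t u) := by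
  refine ⟨C y ^ 6 * (C x ^ 3 * X + C s) ^ 2 + 3 * C y ^ 3 * C (cubicHessian x y s t), ?_⟩
  simp only [cubicHessian, cubicJacobian, map_sub, map_add, map_mul, map_pow, map_ofNat, h.map_u]
  ring

/-- In characteristic 2, `x ^ 3` times the half Jacobian is the Jacobian. -/
theorem dvd_u_of_two_eq_zero (h : IsCubicFlow θ x y s t u) (h2 : (2 : B[X]) = 0) :
    C x ^ 3 * X + C s ∣ C (x ^ 6) * θ u - C (x ^ 3 * cubicHalfJacobian x y s t u) := by
  have h3 : C (x ^ 3 * cubicHalfJacobian x y s t u) = C (cubicJacobian x y s t u) := by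
    simp only [cubicHalfJacobian, cubicJacobian, map_sub, map_add, map_mul, map_pow, map_ofNat]
    linear_combination (2 * C x ^ 3 * C y ^ 3 * C s * C t - C y ^ 6 * C s ^ 3) * h2
  rw [h3]
  exact h.dvd_u

theorem exists_map_eq_add_pow (h : IsCubicFlow θ x y s t u) {p : ℕ} [hp : Fact p.Prime]
    [CharP B p] : ∃ l b : B, θ l = C l ∧
      θ b = C b + C ((x ^ 2 * y ^ 2) ^ p) * X ^ p - C (l * (x ^ 2 * y ^ 2)) * X := by
  by_cases hp3 : p = 3
  · -- In characteristic 3, `θ u = u + x ^ 3 * y ^ 6 * U ^ 3`.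
    subst hp3
    have h3 : (3 : B[X]) = 0 := CharP.cast_eq_zero B[X] 3
    refine ⟨0, x ^ 3 * u, by simp, ?_⟩
    simp only [map_mul, map_pow, map_zero, h.map_x, h.map_u]
    linear_combination (C x ^ 3 * C y ^ 3 * C t * X + C x ^ 3 * C y ^ 6 * C s * X ^ 2) * h3
  · -- The powers of `y` make `θ` translate `W` by `y ^ 2 * U`.
    refine exists_map_eq_add_pow_of_cubic hp3 θ (c := y ^ 2)
      (F := C (x ^ 3) * X ^ 3 + C (3 * y ^ 2 * s) * X ^ 2 + C (3 * y * t) * X + C u)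
      h.map_x (by compute_degree!) (by
        simp only [coeff_add, coeff_C_mul, coeff_X_pow, coeff_X, coeff_C]
        norm_num) ?_
    have hc2 (r : B[X]) : taylor r 3 = 3 := map_ofNat (taylorAlgHom r) 3
    simp only [Polynomial.map_add, Polynomial.map_ofNat, Polynomial.map_mul, Polynomial.map_pow,
      Polynomial.map_C, Polynomial.map_X, map_mul, map_pow, map_ofNat, h.map_x, h.map_y, h.map_s,
      h.map_t, h.map_u, map_add, taylor_mul, taylor_pow, taylor_X, taylor_C, hc2]
    ring

end IsCubicFlow

end BinaryCubic

/-! ### The fixed rings without the variable `v`: DF5 and F6 -/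

section

open MvPolynomial LFIHD

/-- The values on `x, s, t, u` of the restriction of `thetaDF5` to `k[x, s, t, u]`. -/
noncomputable def cubicVars (k : Type*) [Field k] :
    Fin 4 → Polynomial (MvPolynomial (Fin 4) k) :=
  ![Polynomial.C (X 0),
    Polynomial.C (X 1) + Polynomial.C (X 0) ^ 3 * Polynomial.X,
    Polynomial.C (X 2) + 2 * Polynomial.C (X 1) * Polynomial.X +
      Polynomial.C (X 0) ^ 3 * Polynomial.X ^ 2,
    Polynomial.C (X 3) + 3 * Polynomial.C (X 2) * Polynomial.X +
      3 * Polynomial.C (X 1) * Polynomial.X ^ 2 + Polynomial.C (X 0) ^ 3 * Polynomial.X ^ 3]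

/-- The values on `x, y, s, t, u` of the restriction of `thetaF6` to `k[x, y, s, t, u]`. -/
noncomputable def twistedCubicVars (k : Type*) [Field k] :
    Fin 5 → Polynomial (MvPolynomial (Fin 5) k) :=
  ![Polynomial.C (X 0),
    Polynomial.C (X 1),
    Polynomial.C (X 2) + Polynomial.C (X 0) ^ 3 * Polynomial.X,
    Polynomial.C (X 3) + 2 * Polynomial.C (X 1) ^ 3 * Polynomial.C (X 2) * Polynomial.X +
      Polynomial.C (X 0) ^ 3 * Polynomial.C (X 1) ^ 3 * Polynomial.X ^ 2,
    Polynomial.C (X 4) + 3 * Polynomial.C (X 1) ^ 3 * Polynomial.C (X 3) * Polynomial.X +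
      3 * Polynomial.C (X 1) ^ 6 * Polynomial.C (X 2) * Polynomial.X ^ 2 +
      Polynomial.C (X 0) ^ 3 * Polynomial.C (X 1) ^ 6 * Polynomial.X ^ 3]

theorem isCubicFlow_cubicVars (k : Type*) [Field k] :
    IsCubicFlow (aeval (cubicVars k) : MvPolynomial (Fin 4) k →ₐ[k] _).toRingHom
      (X 0) 1 (X 1) (X 2) (X 3) := by
  constructor <;> simp [cubicVars]

theorem isCubicFlow_twistedCubicVars (k : Type*) [Field k] :
    IsCubicFlow (aeval (twistedCubicVars k) : MvPolynomial (Fin 5) k →ₐ[k] _).toRingHom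
      (X 0) (X 1) (X 2) (X 3) (X 4) := by
  constructor <;> simp [twistedCubicVars]

theorem natDegree_slice_pos {k τ : Type*} [Field k] (i : τ) (s : MvPolynomial τ k) :
    0 < (Polynomial.C (X i) ^ 3 * Polynomial.X + Polynomial.C s :
      Polynomial (MvPolynomial τ k)).natDegree := by
  rw [← map_pow, Polynomial.natDegree_linear (pow_ne_zero 3 (X_ne_zero i))]
  exact one_pos

/-- The normal monomials are `f ^ i * g ^ j * d ^ l` with `j ≤ 1`, because
`g ^ 2 = x ^ 6 * d - 4 * f ^ 3`. For `x = t = 0` they are monomials, told apart by the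
exponents of `s` and `u`. -/
theorem fixedSubalgebra_cubicVars_fg_of_two_ne_zero {k : Type*} [Field k]
    (h2 : (2 : k) ≠ 0) :
    (fixedSubalgebra (aeval (cubicVars k))).FG := by
  have H := isCubicFlow_cubicVars k
  set x : MvPolynomial (Fin 4) k := X 0 with hx
  set s : MvPolynomial (Fin 4) k := X 1 with hs
  set t : MvPolynomial (Fin 4) k := X 2 with ht
  set u : MvPolynomial (Fin 4) k := X 3 with hu
  set f := cubicHessian x 1 s t with hf
  set g := cubicJacobian x 1 s t u with hg
  set d := cubicDiscr x 1 s t u with hd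
  have hrel : g ^ 2 = x ^ 6 * d - 4 * f ^ 3 := by
    simpa using cubicJacobian_sq x 1 s t u
  have hmem (i : Fin 4) : ![x, f, g, d] i ∈ Algebra.adjoin k (Set.range ![x, f, g, d]) :=
    Algebra.subset_adjoin ⟨i, rfl⟩
  have hxA := hmem 0
  have hfA := hmem 1
  have hgA := hmem 2
  have hdA := hmem 3
  simp only [Matrix.cons_val] at hxA hfA hgA hdA
  refine fixedSubalgebra_fg_of_normalForm (G := ![x, f, g, d]) (i₀ := 0)
    (L := Polynomial.C x ^ 3 * Polynomial.X + Polynomial.C s) (N := ℕ × Fin 2 × ℕ)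
    ?_ (X_ne_zero 0) (natDegree_slice_pos 0 s) ?_ (fun n => f ^ n.1 * g ^ (n.2.1 : ℕ) * d ^ n.2.2)
    ?_ (aeval ![0, s, 0, u]) ?_ (fun n => (-1) ^ n.1 * 2 ^ (n.2.1 : ℕ) * 4 ^ n.2.2)
    (fun n => ![0, 2 * n.1 + 3 * n.2.1 + 3 * n.2.2, 0, n.2.2]) ?_ ?_ ?_
  · intro i
    fin_cases i
    exacts [H.map_x, H.map_hessian, H.map_jacobian, H.map_discr]
  · intro j
    fin_cases j
    exacts [⟨0, x, hxA, H.dvd_x⟩, ⟨0, 0, zero_mem _, H.dvd_s⟩, ⟨3, f, hfA, H.dvd_t⟩,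
      ⟨6, g, hgA, H.dvd_u⟩]
  · intro M hw hM m hm
    have key : ∀ j i l, f ^ i * g ^ j * d ^ l ∈ M := by
      intro j
      induction j using Nat.twoStepInduction with
      | zero => exact fun i l => hw (i, 0, l)
      | one => exact fun i l => hw (i, 1, l)
      | more j ih _ =>
        intro i l
        have h1 : f ^ i * g ^ (j + 2) * d ^ l =
            x * (x ^ 5 * f ^ i * g ^ j * d ^ (l + 1)) -
              (4 : k) • (f ^ (i + 3) * g ^ j * d ^ l) := by
          rw [pow_add g, hrel, Algebra.smul_def, map_ofNat]
          ring
        rw [h1]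
        have h3 := hM ![5, i, j, l + 1]
        simp only [Fin.prod_univ_four, Matrix.cons_val] at h3
        exact M.sub_mem h3 (M.smul_mem _ (ih _ _))
    simp only [Fin.prod_univ_four, Matrix.cons_val, hm, pow_zero, one_mul]
    exact key (m 2) (m 1) (m 3)
  · simp [hx]
  · intro n
    have h4 : (4 : k) ≠ 0 := by
      rw [show (4 : k) = 2 * 2 by norm_num]
      exact mul_ne_zero h2 h2
    exact mul_ne_zero (mul_ne_zero (pow_ne_zero _ (neg_ne_zero.2 one_ne_zero))
      (pow_ne_zero _ h2)) (pow_ne_zero _ h4)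
  · rintro ⟨i, j, l⟩ ⟨i', j', l'⟩ h
    have h1 := congrFun h 1
    have h3 := congrFun h 3
    simp only [Matrix.cons_val] at h1 h3
    simp only [Prod.mk.injEq, Fin.ext_iff]
    omega
  · rintro ⟨i, j, l⟩
    have e1 : aeval ![0, s, 0, u] f = -1 * (s ^ 2) := by
      simp only [hf, cubicHessian, map_sub, map_mul, map_pow, map_one, hx, hs, ht, hu,
        aeval_X, Matrix.cons_val]
      ring
    have e2 : aeval ![0, s, 0, u] g = 2 * (s ^ 3) := by
      simp only [hg, cubicJacobian, map_sub, map_add, map_mul, map_pow, map_ofNat, map_one, hx, hs,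
        ht, hu, aeval_X, Matrix.cons_val]
      ring
    have e3 : aeval ![0, s, 0, u] d = 4 * (s ^ 3 * u) := by
      simp only [hd, cubicDiscr, map_sub, map_add, map_mul, map_pow, map_ofNat, map_one, hx, hs,
        ht, hu, aeval_X, Matrix.cons_val]
      ring
    simp only [map_mul, map_pow, e1, e2, e3, Fin.prod_univ_four, Matrix.cons_val, map_neg,
      map_one, map_ofNat, pow_zero]
    simp only [hs, hu]
    ring

/-- In characteristic 2 there is no relation: the monomials `f ^ i * g ^ j` stay distinct
for `x = 0`. -/
theorem fixedSubalgebra_cubicVars_fg_of_two_eq_zero {k : Type*} [Field k]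
    (h2 : (2 : k) = 0) :
    (fixedSubalgebra (aeval (cubicVars k))).FG := by
  have H := isCubicFlow_cubicVars k
  have h2B : (2 : MvPolynomial (Fin 4) k) = 0 := by
    rw [← map_ofNat (algebraMap k (MvPolynomial (Fin 4) k)) 2, h2, map_zero]
  have h2U : (2 : Polynomial (MvPolynomial (Fin 4) k)) = 0 := by
    rw [← map_ofNat Polynomial.C 2, h2B, map_zero]
  set x : MvPolynomial (Fin 4) k := X 0 with hx
  set s : MvPolynomial (Fin 4) k := X 1 with hs
  set t : MvPolynomial (Fin 4) k := X 2 with ht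
  set u : MvPolynomial (Fin 4) k := X 3 with hu
  set f := cubicHessian x 1 s t with hf
  set g := cubicHalfJacobian x 1 s t u with hg
  have hmem (i : Fin 3) : ![x, f, g] i ∈ Algebra.adjoin k (Set.range ![x, f, g]) :=
    Algebra.subset_adjoin ⟨i, rfl⟩
  have hxA := hmem 0
  have hfA := hmem 1
  have hgA := hmem 2
  simp only [Matrix.cons_val] at hxA hfA hgA
  refine fixedSubalgebra_fg_of_normalForm (G := ![x, f, g]) (i₀ := 0)
    (L := Polynomial.C x ^ 3 * Polynomial.X + Polynomial.C s) (N := ℕ × ℕ)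
    ?_ (X_ne_zero 0) (natDegree_slice_pos 0 s) ?_ (fun n => f ^ n.1 * g ^ n.2)
    ?_ (aeval ![0, s, t, u]) ?_ (fun n => (-1) ^ n.1)
    (fun n => ![0, 2 * n.1 + n.2, n.2, 0]) ?_ ?_ ?_
  · intro i
    fin_cases i
    exacts [H.map_x, H.map_hessian, H.map_halfJacobian h2U]
  · intro j
    fin_cases j
    exacts [⟨0, x, hxA, H.dvd_x⟩, ⟨0, 0, zero_mem _, H.dvd_s⟩, ⟨3, f, hfA, H.dvd_t⟩,
      ⟨6, x ^ 3 * g, mul_mem (pow_mem hxA 3) hgA, H.dvd_u_of_two_eq_zero h2U⟩]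
  · intro M hw hM m hm
    simp only [Fin.prod_univ_three, Matrix.cons_val, hm, pow_zero, one_mul]
    exact hw (m 1, m 2)
  · simp [hx]
  · exact fun n => pow_ne_zero _ (neg_ne_zero.2 one_ne_zero)
  · rintro ⟨i, j⟩ ⟨i', j'⟩ h
    have h1 := congrFun h 1
    have h3 := congrFun h 2
    simp only [Matrix.cons_val] at h1 h3
    simp only [Prod.mk.injEq]
    omega
  · rintro ⟨i, j⟩
    have e1 : aeval ![0, s, t, u] f = -1 * (s ^ 2) := by
      simp only [hf, cubicHessian, map_sub, map_mul, map_pow, map_one, hx, hs, ht, hu,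
        aeval_X, Matrix.cons_val]
      ring
    have e2 : aeval ![0, s, t, u] g = s * t := by
      simp only [hg, cubicHalfJacobian, map_add, map_mul, map_pow, map_one, hx, hs, ht, hu,
        aeval_X, Matrix.cons_val]
      ring
    simp only [map_mul, map_pow, e1, e2, Fin.prod_univ_four, Matrix.cons_val, map_neg,
      map_one, pow_zero]
    simp only [hs, ht]
    ring

/-- The normal monomials are `y ^ a * f ^ i * g ^ j * d ^ l` with `j ≤ 1`, because
`g ^ 2 = x ^ 6 * d - 4 * y ^ 3 * f ^ 3`. For `x = t = 0` they are monomials, told apart by the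
exponents of `y, s, u`. -/
theorem fixedSubalgebra_twistedCubicVars_fg_of_two_ne_zero {k : Type*} [Field k]
    (h2 : (2 : k) ≠ 0) :
    (fixedSubalgebra (aeval (twistedCubicVars k))).FG := by
  have H := isCubicFlow_twistedCubicVars k
  set x : MvPolynomial (Fin 5) k := X 0 with hx
  set y : MvPolynomial (Fin 5) k := X 1 with hy
  set s : MvPolynomial (Fin 5) k := X 2 with hs
  set t : MvPolynomial (Fin 5) k := X 3 with ht
  set u : MvPolynomial (Fin 5) k := X 4 with hu
  set f := cubicHessian x y s t with hf
  set g := cubicJacobian x y s t u with hg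
  set d := cubicDiscr x y s t u with hd
  have hrel : g ^ 2 = x ^ 6 * d - 4 * y ^ 3 * f ^ 3 :=
    cubicJacobian_sq x y s t u
  have hmem (i : Fin 5) : ![x, y, f, g, d] i ∈ Algebra.adjoin k (Set.range ![x, y, f, g, d]) :=
    Algebra.subset_adjoin ⟨i, rfl⟩
  have hxA := hmem 0
  have hyA := hmem 1
  have hfA := hmem 2
  have hgA := hmem 3
  simp only [Matrix.cons_val] at hxA hyA hfA hgA
  refine fixedSubalgebra_fg_of_normalForm (G := ![x, y, f, g, d]) (i₀ := 0)
    (L := Polynomial.C x ^ 3 * Polynomial.X + Polynomial.C s) (N := ℕ × ℕ × Fin 2 × ℕ)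
    ?_ (X_ne_zero 0) (natDegree_slice_pos 0 s) ?_
    (fun n => y ^ n.1 * f ^ n.2.1 * g ^ (n.2.2.1 : ℕ) * d ^ n.2.2.2) ?_
    (aeval ![0, y, s, 0, u]) ?_ (fun n => (-1) ^ n.2.1 * 2 ^ (n.2.2.1 : ℕ) * 4 ^ n.2.2.2)
    (fun n => ![0, n.1 + 3 * n.2.1 + 6 * n.2.2.1 + 6 * n.2.2.2,
      2 * n.2.1 + 3 * n.2.2.1 + 3 * n.2.2.2, 0, n.2.2.2]) ?_ ?_ ?_
  · intro i
    fin_cases i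
    exacts [H.map_x, H.map_y, H.map_hessian, H.map_jacobian, H.map_discr]
  · intro j
    fin_cases j
    exacts [⟨0, x, hxA, H.dvd_x⟩, ⟨0, y, hyA, H.dvd_y⟩, ⟨0, 0, zero_mem _, H.dvd_s⟩,
      ⟨3, f, hfA, H.dvd_t⟩, ⟨6, g, hgA, H.dvd_u⟩]
  · intro M hw hM m hm
    have key : ∀ j a i l, y ^ a * f ^ i * g ^ j * d ^ l ∈ M := by
      intro j
      induction j using Nat.twoStepInduction with
      | zero => exact fun a i l => hw (a, i, 0, l)
      | one => exact fun a i l => hw (a, i, 1, l)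
      | more j ih _ =>
        intro a i l
        have h1 : y ^ a * f ^ i * g ^ (j + 2) * d ^ l =
            x * (x ^ 5 * y ^ a * f ^ i * g ^ j * d ^ (l + 1)) -
              (4 : k) • (y ^ (a + 3) * f ^ (i + 3) * g ^ j * d ^ l) := by
          rw [pow_add g, hrel, Algebra.smul_def, map_ofNat]
          ring
        rw [h1]
        have h3 := hM ![5, a, i, j, l + 1]
        simp only [Fin.prod_univ_five, Matrix.cons_val] at h3
        exact M.sub_mem h3 (M.smul_mem _ (ih _ _ _))
    simp only [Fin.prod_univ_five, Matrix.cons_val, hm, pow_zero, one_mul]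
    exact key (m 3) (m 1) (m 2) (m 4)
  · simp [hx]
  · intro n
    have h4 : (4 : k) ≠ 0 := by
      rw [show (4 : k) = 2 * 2 by norm_num]
      exact mul_ne_zero h2 h2
    exact mul_ne_zero (mul_ne_zero (pow_ne_zero _ (neg_ne_zero.2 one_ne_zero))
      (pow_ne_zero _ h2)) (pow_ne_zero _ h4)
  · rintro ⟨a, i, j, l⟩ ⟨a', i', j', l'⟩ h
    have h1 := congrFun h 1
    have h2 := congrFun h 2
    have h3 := congrFun h 4
    simp only [Matrix.cons_val] at h1 h2 h3
    simp only [Prod.mk.injEq, Fin.ext_iff]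
    omega
  · rintro ⟨a, i, j, l⟩
    have ey : aeval ![0, y, s, 0, u] y = y := aeval_X _ _
    have e1 : aeval ![0, y, s, 0, u] f = -1 * (y ^ 3 * s ^ 2) := by
      simp only [hf, cubicHessian, map_sub, map_mul, map_pow, hx, hs, ht, hu,
        hy, aeval_X, Matrix.cons_val]
      ring
    have e2 : aeval ![0, y, s, 0, u] g = 2 * (y ^ 6 * s ^ 3) := by
      simp only [hg, cubicJacobian, map_sub, map_add, map_mul, map_pow, map_ofNat, hx, hs, ht, hu,
        hy, aeval_X, Matrix.cons_val]
      ring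
    have e3 : aeval ![0, y, s, 0, u] d = 4 * (y ^ 6 * s ^ 3 * u) := by
      simp only [hd, cubicDiscr, map_sub, map_add, map_mul, map_pow, map_ofNat, hx, hs, ht, hu,
        hy, aeval_X, Matrix.cons_val]
      ring
    simp only [map_mul, map_pow, e1, e2, e3, Fin.prod_univ_five, Matrix.cons_val, map_neg,
      map_one, map_ofNat, ey, pow_zero]
    simp only [hy, hs, hu]
    ring

/-- In characteristic 2 there is no relation: the monomials `y ^ a * f ^ i * g ^ j` stay distinct
for `x = 0`. -/
theorem fixedSubalgebra_twistedCubicVars_fg_of_two_eq_zero {k : Type*} [Field k]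
    (h2 : (2 : k) = 0) :
    (fixedSubalgebra (aeval (twistedCubicVars k))).FG := by
  have H := isCubicFlow_twistedCubicVars k
  have h2B : (2 : MvPolynomial (Fin 5) k) = 0 := by
    rw [← map_ofNat (algebraMap k (MvPolynomial (Fin 5) k)) 2, h2, map_zero]
  have h2U : (2 : Polynomial (MvPolynomial (Fin 5) k)) = 0 := by
    rw [← map_ofNat Polynomial.C 2, h2B, map_zero]
  set x : MvPolynomial (Fin 5) k := X 0 with hx
  set y : MvPolynomial (Fin 5) k := X 1 with hy
  set s : MvPolynomial (Fin 5) k := X 2 with hs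
  set t : MvPolynomial (Fin 5) k := X 3 with ht
  set u : MvPolynomial (Fin 5) k := X 4 with hu
  set f := cubicHessian x y s t with hf
  set g := cubicHalfJacobian x y s t u with hg
  have hmem (i : Fin 4) : ![x, y, f, g] i ∈ Algebra.adjoin k (Set.range ![x, y, f, g]) :=
    Algebra.subset_adjoin ⟨i, rfl⟩
  have hxA := hmem 0
  have hyA := hmem 1
  have hfA := hmem 2
  have hgA := hmem 3
  simp only [Matrix.cons_val] at hxA hyA hfA hgA
  refine fixedSubalgebra_fg_of_normalForm (G := ![x, y, f, g]) (i₀ := 0)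
    (L := Polynomial.C x ^ 3 * Polynomial.X + Polynomial.C s) (N := ℕ × ℕ × ℕ)
    ?_ (X_ne_zero 0) (natDegree_slice_pos 0 s) ?_ (fun n => y ^ n.1 * f ^ n.2.1 * g ^ n.2.2)
    ?_ (aeval ![0, y, s, t, u]) ?_ (fun n => (-1) ^ n.2.1)
    (fun n => ![0, n.1 + 3 * n.2.1 + 3 * n.2.2, 2 * n.2.1 + n.2.2, n.2.2, 0]) ?_ ?_ ?_
  · intro i
    fin_cases i
    exacts [H.map_x, H.map_y, H.map_hessian, H.map_halfJacobian h2U]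
  · intro j
    fin_cases j
    exacts [⟨0, x, hxA, H.dvd_x⟩, ⟨0, y, hyA, H.dvd_y⟩, ⟨0, 0, zero_mem _, H.dvd_s⟩,
      ⟨3, f, hfA, H.dvd_t⟩,
      ⟨6, x ^ 3 * g, mul_mem (pow_mem hxA 3) hgA, H.dvd_u_of_two_eq_zero h2U⟩]
  · intro M hw hM m hm
    simp only [Fin.prod_univ_four, Matrix.cons_val, hm, pow_zero, one_mul]
    exact hw (m 1, m 2, m 3)
  · simp [hx]
  · exact fun n => pow_ne_zero _ (neg_ne_zero.2 one_ne_zero)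
  · rintro ⟨a, i, j⟩ ⟨a', i', j'⟩ h
    have h1 := congrFun h 1
    have h2 := congrFun h 2
    have h3 := congrFun h 3
    simp only [Matrix.cons_val] at h1 h2 h3
    simp only [Prod.mk.injEq]
    omega
  · rintro ⟨a, i, j⟩
    have ey : aeval ![0, y, s, t, u] y = y := aeval_X _ _
    have e1 : aeval ![0, y, s, t, u] f = -1 * (y ^ 3 * s ^ 2) := by
      simp only [hf, cubicHessian, map_sub, map_mul, map_pow, hx, hy, hs, ht, hu,
        aeval_X, Matrix.cons_val]
      ring
    have e2 : aeval ![0, y, s, t, u] g = y ^ 3 * s * t := by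
      simp only [hg, cubicHalfJacobian, map_add, map_mul, map_pow, hx, hy, hs, ht, hu,
        aeval_X, Matrix.cons_val]
      ring
    simp only [map_mul, map_pow, e1, e2, Fin.prod_univ_five, Matrix.cons_val, map_neg,
      map_one, ey, pow_zero]
    simp only [hy, hs, ht]
    ring

end

/-! ### The fixed ring without the variable `v`: R7 -/

section

section

open Polynomial

/-- The case of `exists_map_eq_add_pow_of_cubic` in which `F` is the product of the
`x_i ^ 3 * W + y_i`, including `p = 3`. -/
theorem exists_map_eq_add_pow_of_pairs {B : Type*} [CommRing B] {θ : B →+* B[X]}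
    {x₁ x₂ x₃ y₁ y₂ y₃ : B} (hx₁ : θ x₁ = C x₁) (hx₂ : θ x₂ = C x₂) (hx₃ : θ x₃ = C x₃)
    (hy₁ : θ y₁ = C y₁ + C x₁ ^ 3 * X) (hy₂ : θ y₂ = C y₂ + C x₂ ^ 3 * X)
    (hy₃ : θ y₃ = C y₃ + C x₃ ^ 3 * X) {p : ℕ} [hp : Fact p.Prime] [CharP B p] :
    ∃ l b : B, θ l = C l ∧
      θ b = C b + C ((x₁ ^ 2 * x₂ ^ 2 * x₃ ^ 2) ^ p) * X ^ p -
        C (l * (x₁ ^ 2 * x₂ ^ 2 * x₃ ^ 2)) * X := by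
  by_cases hp3 : p = 3
  · subst hp3
    have h3 : (3 : B[X]) = 0 := CharP.cast_eq_zero B[X] 3
    -- In the fractions `e_i = y_i / x_i ^ 3`, this is `(x₁ x₂ x₃) ^ 6` times a form of degree 3 of
    -- degree at most 2 in each `e_i`, which a translation of the `e_i` by `U` changes by `U ^ 3`.
    refine ⟨0, -(x₁ ^ 3 * x₂ ^ 6 * y₁ * y₃ ^ 2) - x₂ ^ 6 * x₃ ^ 3 * y₁ ^ 2 * y₃ +
      x₁ ^ 6 * x₂ ^ 3 * y₂ * y₃ ^ 2 + x₁ ^ 3 * x₂ ^ 3 * x₃ ^ 3 * y₁ * y₂ * y₃ +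
      x₂ ^ 3 * x₃ ^ 6 * y₁ ^ 2 * y₂, by simp, ?_⟩
    simp only [map_add, map_sub, map_neg, map_mul, map_pow, map_zero, hx₁, hx₂, hx₃, hy₁, hy₂, hy₃]
    linear_combination (-(C x₁ ^ 3 * C x₂ ^ 6 * C x₃ ^ 3 * C y₁ * C y₃ * X) +
      C x₁ ^ 6 * C x₂ ^ 3 * C x₃ ^ 3 * C y₂ * C y₃ * X +
      C x₁ ^ 3 * C x₂ ^ 3 * C x₃ ^ 6 * C y₁ * C y₂ * X +
      C x₁ ^ 6 * C x₂ ^ 3 * C x₃ ^ 6 * C y₂ * X ^ 2) * h3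
  · obtain ⟨l, b, hl, hb⟩ := exists_map_eq_add_pow_of_cubic hp3 θ (c := 1) (z := x₁ * x₂ * x₃)
      (F := (C (x₁ ^ 3) * X + C y₁) * (C (x₂ ^ 3) * X + C y₂) * (C (x₃ ^ 3) * X + C y₃))
      (by simp [hx₁, hx₂, hx₃])
      ((natDegree_mul_le_of_le (natDegree_mul_le_of_le natDegree_linear_le natDegree_linear_le)
        natDegree_linear_le))
      (by
        rw [show (3 : ℕ) = 1 + 1 + 1 from rfl, coeff_mul_add_eq_of_natDegree_le
          (natDegree_mul_le_of_le natDegree_linear_le natDegree_linear_le) natDegree_linear_le,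
          coeff_mul_add_eq_of_natDegree_le natDegree_linear_le natDegree_linear_le]
        simp only [coeff_add, coeff_C_mul, coeff_X_one, coeff_C_succ]
        ring)
      (by
        simp only [Polynomial.map_add, Polynomial.map_mul, Polynomial.map_pow, Polynomial.map_C,
          Polynomial.map_X, map_pow, map_one, hx₁, hx₂, hx₃, hy₁, hy₂, hy₃, map_add, map_mul,
          taylor_mul, taylor_pow, taylor_X, taylor_C]
        ring)
    rw [show (x₁ * x₂ * x₃) ^ 2 * 1 = x₁ ^ 2 * x₂ ^ 2 * x₃ ^ 2 by ring] at hb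
    exact ⟨l, b, hl, hb⟩

end

open MvPolynomial LFIHD

/-- The values on `x₁, x₂, x₃, y₁, y₂, y₃` of the restriction of `thetaR7` to
`k[x₁, x₂, x₃, y₁, y₂, y₃]`. -/
noncomputable def pairsVars (k : Type*) [Field k] :
    Fin 6 → Polynomial (MvPolynomial (Fin 6) k) :=
  ![Polynomial.C (X 0),
    Polynomial.C (X 1),
    Polynomial.C (X 2),
    Polynomial.C (X 3) + Polynomial.C (X 0) ^ 3 * Polynomial.X,
    Polynomial.C (X 4) + Polynomial.C (X 1) ^ 3 * Polynomial.X,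
    Polynomial.C (X 5) + Polynomial.C (X 2) ^ 3 * Polynomial.X]

/-- The relation `x₃ ^ 3 * z₁₂ = x₂ ^ 3 * z₁₃ - x₁ ^ 3 * z₂₃` allows to assume in a normal monomial
that `x₃` has exponent less than 3 or that `z₁₂` does not occur. For `x₁ = y₂ = 0` the normal
monomials become distinct monomials up to sign. -/
theorem fixedSubalgebra_pairsVars_fg (k : Type*) [Field k] :
    (fixedSubalgebra (aeval (pairsVars k))).FG := by
  set x₁ : MvPolynomial (Fin 6) k := X 0 with hx₁
  set x₂ : MvPolynomial (Fin 6) k := X 1 with hx₂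
  set x₃ : MvPolynomial (Fin 6) k := X 2 with hx₃
  set y₁ : MvPolynomial (Fin 6) k := X 3 with hy₁
  set y₂ : MvPolynomial (Fin 6) k := X 4 with hy₂
  set y₃ : MvPolynomial (Fin 6) k := X 5 with hy₃
  set θ : MvPolynomial (Fin 6) k →ₐ[k] _ := aeval (pairsVars k) with hθ
  have θx₁ : θ x₁ = Polynomial.C x₁ := by simp [hθ, hx₁, pairsVars]
  have θx₂ : θ x₂ = Polynomial.C x₂ := by simp [hθ, hx₂, pairsVars]
  have θx₃ : θ x₃ = Polynomial.C x₃ := by simp [hθ, hx₃, pairsVars]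
  have θy₁ : θ y₁ = Polynomial.C y₁ + Polynomial.C x₁ ^ 3 * Polynomial.X := by
    simp [hθ, hx₁, hy₁, pairsVars]
  have θy₂ : θ y₂ = Polynomial.C y₂ + Polynomial.C x₂ ^ 3 * Polynomial.X := by
    simp [hθ, hx₂, hy₂, pairsVars]
  have θy₃ : θ y₃ = Polynomial.C y₃ + Polynomial.C x₃ ^ 3 * Polynomial.X := by
    simp [hθ, hx₃, hy₃, pairsVars]
  obtain ⟨z₁₂, hz₁₂⟩ : ∃ z, z = x₁ ^ 3 * y₂ - x₂ ^ 3 * y₁ := ⟨_, rfl⟩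
  obtain ⟨z₁₃, hz₁₃⟩ : ∃ z, z = x₁ ^ 3 * y₃ - x₃ ^ 3 * y₁ := ⟨_, rfl⟩
  obtain ⟨z₂₃, hz₂₃⟩ : ∃ z, z = x₂ ^ 3 * y₃ - x₃ ^ 3 * y₂ := ⟨_, rfl⟩
  have hrel : x₃ ^ 3 * z₁₂ = x₂ ^ 3 * z₁₃ - x₁ ^ 3 * z₂₃ := by
    rw [hz₁₂, hz₁₃, hz₂₃]
    ring
  have hmem (i : Fin 6) : ![x₁, x₂, x₃, z₁₂, z₁₃, z₂₃] i ∈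
      Algebra.adjoin k (Set.range ![x₁, x₂, x₃, z₁₂, z₁₃, z₂₃]) :=
    Algebra.subset_adjoin ⟨i, rfl⟩
  refine fixedSubalgebra_fg_of_normalForm (G := ![x₁, x₂, x₃, z₁₂, z₁₃, z₂₃]) (i₀ := 0)
    (L := Polynomial.C x₁ ^ 3 * Polynomial.X + Polynomial.C y₁)
    (N := {n : ℕ × ℕ × ℕ × ℕ × ℕ // n.2.1 < 3 ∨ n.2.2.1 = 0})
    ?_ (X_ne_zero 0) ?_ ?_
    (fun n => x₂ ^ n.1.1 * x₃ ^ n.1.2.1 * z₁₂ ^ n.1.2.2.1 * z₁₃ ^ n.1.2.2.2.1 *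
      z₂₃ ^ n.1.2.2.2.2)
    ?_ (aeval ![0, x₂, x₃, y₁, 0, y₃]) ?_ (fun n => (-1) ^ (n.1.2.2.1 + n.1.2.2.2.1))
    (fun n => ![0, n.1.1 + 3 * n.1.2.2.1 + 3 * n.1.2.2.2.2, n.1.2.1 + 3 * n.1.2.2.2.1,
      n.1.2.2.1 + n.1.2.2.2.1, 0, n.1.2.2.2.2]) ?_ ?_ ?_
  · have h12 : θ z₁₂ = Polynomial.C z₁₂ := by
      simp only [hz₁₂, map_sub, map_mul, map_pow, θx₁, θx₂, θy₁, θy₂]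
      ring
    have h13 : θ z₁₃ = Polynomial.C z₁₃ := by
      simp only [hz₁₃, map_sub, map_mul, map_pow, θx₁, θx₃, θy₁, θy₃]
      ring
    have h23 : θ z₂₃ = Polynomial.C z₂₃ := by
      simp only [hz₂₃, map_sub, map_mul, map_pow, θx₂, θx₃, θy₂, θy₃]
      ring
    intro i
    fin_cases i
    exacts [θx₁, θx₂, θx₃, h12, h13, h23]
  · rw [← map_pow, Polynomial.natDegree_linear (pow_ne_zero 3 (X_ne_zero 0))]
    exact one_pos
  · have d12 : Polynomial.C x₁ ^ 3 * Polynomial.X + Polynomial.C y₁ ∣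
        Polynomial.C (x₁ ^ 3) * θ y₂ - Polynomial.C z₁₂ := by
      refine ⟨Polynomial.C x₂ ^ 3, ?_⟩
      simp only [hz₁₂, map_sub, map_mul, map_pow, θy₂]
      ring
    have d13 : Polynomial.C x₁ ^ 3 * Polynomial.X + Polynomial.C y₁ ∣
        Polynomial.C (x₁ ^ 3) * θ y₃ - Polynomial.C z₁₃ := by
      refine ⟨Polynomial.C x₃ ^ 3, ?_⟩
      simp only [hz₁₃, map_sub, map_mul, map_pow, θy₃]
      ring
    have d0 (z : MvPolynomial (Fin 6) k) (hz : θ z = Polynomial.C z) :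
        Polynomial.C x₁ ^ 3 * Polynomial.X + Polynomial.C y₁ ∣
          Polynomial.C (x₁ ^ 0) * θ z - Polynomial.C z :=
      ⟨0, by simp [hz]⟩
    have d1 : Polynomial.C x₁ ^ 3 * Polynomial.X + Polynomial.C y₁ ∣
          Polynomial.C (x₁ ^ 0) * θ y₁ - Polynomial.C 0 :=
      ⟨1, by simp [θy₁, add_comm]⟩
    intro j
    fin_cases j
    exacts [⟨0, x₁, hmem 0, d0 _ θx₁⟩, ⟨0, x₂, hmem 1, d0 _ θx₂⟩, ⟨0, x₃, hmem 2, d0 _ θx₃⟩,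
      ⟨0, 0, zero_mem _, d1⟩, ⟨3, z₁₂, hmem 3, d12⟩, ⟨3, z₁₃, hmem 4, d13⟩]
  · intro M hw hM m hm
    have key : ∀ i a b j l, x₂ ^ a * x₃ ^ b * z₁₂ ^ i * z₁₃ ^ j * z₂₃ ^ l ∈ M := by
      intro i
      induction i with
      | zero => exact fun a b j l => hw ⟨(a, b, 0, j, l), Or.inr rfl⟩
      | succ i ih =>
        intro a b j l
        rcases lt_or_ge b 3 with hb | hb
        · exact hw ⟨(a, b, i + 1, j, l), Or.inl hb⟩
        · obtain ⟨b, rfl⟩ := Nat.exists_eq_add_of_le' hb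
          have h1 : x₂ ^ a * x₃ ^ (b + 3) * z₁₂ ^ (i + 1) * z₁₃ ^ j * z₂₃ ^ l =
              x₂ ^ (a + 3) * x₃ ^ b * z₁₂ ^ i * z₁₃ ^ (j + 1) * z₂₃ ^ l -
                x₁ * (x₁ ^ 2 * x₂ ^ a * x₃ ^ b * z₁₂ ^ i * z₁₃ ^ j * z₂₃ ^ (l + 1)) := by
            linear_combination (x₂ ^ a * x₃ ^ b * z₁₂ ^ i * z₁₃ ^ j * z₂₃ ^ l) * hrel
          have h2 := hM ![2, a, b, i, j, l + 1]
          simp only [Fin.prod_univ_six, Matrix.cons_val] at h2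
          rw [h1]
          exact M.sub_mem (ih _ _ _ _) h2
    simp only [Fin.prod_univ_six, Matrix.cons_val, hm, pow_zero, one_mul]
    exact key (m 3) (m 1) (m 2) (m 4) (m 5)
  · simp [hx₁]
  · exact fun n => pow_ne_zero _ (neg_ne_zero.2 one_ne_zero)
  · rintro ⟨⟨a, b, i, j, l⟩, hn⟩ ⟨⟨a', b', i', j', l'⟩, hn'⟩ h
    have h1 := congrFun h 1
    have h2 := congrFun h 2
    have h3 := congrFun h 3
    have h5 := congrFun h 5
    simp only [Matrix.cons_val] at h1 h2 h3 h5 hn hn'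
    simp only [Subtype.mk.injEq, Prod.mk.injEq]
    omega
  · rintro ⟨⟨a, b, i, j, l⟩, hn⟩
    have ex₂ : aeval ![0, x₂, x₃, y₁, 0, y₃] x₂ = x₂ := aeval_X _ _
    have ex₃ : aeval ![0, x₂, x₃, y₁, 0, y₃] x₃ = x₃ := aeval_X _ _
    have e1 : aeval ![0, x₂, x₃, y₁, 0, y₃] z₁₂ = -1 * (x₂ ^ 3 * y₁) := by
      simp only [hz₁₂, map_sub, map_mul, map_pow, hx₁, hx₂, hy₁, hy₂, aeval_X, Matrix.cons_val]
      ring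
    have e2 : aeval ![0, x₂, x₃, y₁, 0, y₃] z₁₃ = -1 * (x₃ ^ 3 * y₁) := by
      simp only [hz₁₃, map_sub, map_mul, map_pow, hx₁, hx₃, hy₁, hy₃, aeval_X, Matrix.cons_val]
      ring
    have e3 : aeval ![0, x₂, x₃, y₁, 0, y₃] z₂₃ = x₂ ^ 3 * y₃ := by
      simp only [hz₂₃, map_sub, map_mul, map_pow, hx₂, hx₃, hy₂, hy₃, aeval_X, Matrix.cons_val]
      ring
    simp only [map_mul, map_pow, e1, e2, e3, Fin.prod_univ_six, Matrix.cons_val, map_neg,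
      map_one, ex₂, ex₃, pow_zero]
    simp only [hx₂, hx₃, hy₁, hy₃]
    ring

end

/-! ### The three examples -/

section

open MvPolynomial LFIHD

theorem thetaDF5_invariants_fg {k : Type*} [Field k] {p : ℕ} [Fact p.Prime] [CharP k p] :
    (thetaDF5 k).invariants.FG := by
  have : CharP (MvPolynomial (Fin 4) k) p := charP_of_injective_algebraMap' k p
  obtain ⟨l, b, hl, hb⟩ := (isCubicFlow_cubicVars k).exists_map_eq_add_pow (p := p)
  refine fg_invariants_of_monic (p := p) (cubicVars k) (X 0 ^ 2 * 1 ^ 2) (thetaDF5 k) ?_ ?_ ?_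
    l b hl hb
  · intro i
    change aeval (df5Vars k) _ = _
    fin_cases i <;> simp [df5Vars, cubicVars]
  · change aeval (df5Vars k) _ = _
    rw [aeval_X]
    simp [df5Vars, Fin.last]
  · by_cases h2 : (2 : k) = 0
    exacts [fixedSubalgebra_cubicVars_fg_of_two_eq_zero h2,
      fixedSubalgebra_cubicVars_fg_of_two_ne_zero h2]

theorem thetaF6_invariants_fg {k : Type*} [Field k] {p : ℕ} [Fact p.Prime] [CharP k p] :
    (thetaF6 k).invariants.FG := by
  have : CharP (MvPolynomial (Fin 5) k) p := charP_of_injective_algebraMap' k p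
  obtain ⟨l, b, hl, hb⟩ := (isCubicFlow_twistedCubicVars k).exists_map_eq_add_pow (p := p)
  refine fg_invariants_of_monic (p := p) (twistedCubicVars k) (X 0 ^ 2 * X 1 ^ 2) (thetaF6 k)
    ?_ ?_ ?_ l b hl hb
  · intro i
    change aeval (f6Vars k) _ = _
    fin_cases i <;> simp [f6Vars, twistedCubicVars]
  · change aeval (f6Vars k) _ = _
    rw [aeval_X]
    simp [f6Vars, Fin.last]
  · by_cases h2 : (2 : k) = 0
    exacts [fixedSubalgebra_twistedCubicVars_fg_of_two_eq_zero h2,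
      fixedSubalgebra_twistedCubicVars_fg_of_two_ne_zero h2]

theorem thetaR7_invariants_fg {k : Type*} [Field k] {p : ℕ} [Fact p.Prime] [CharP k p] :
    (thetaR7 k).invariants.FG := by
  have : CharP (MvPolynomial (Fin 6) k) p := charP_of_injective_algebraMap' k p
  obtain ⟨l, b, hl, hb⟩ := exists_map_eq_add_pow_of_pairs (p := p)
    (θ := (aeval (pairsVars k) : MvPolynomial (Fin 6) k →ₐ[k] _).toRingHom)
    (x₁ := X 0) (x₂ := X 1) (x₃ := X 2) (y₁ := X 3) (y₂ := X 4) (y₃ := X 5)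
    (by simp [pairsVars]) (by simp [pairsVars]) (by simp [pairsVars]) (by simp [pairsVars])
    (by simp [pairsVars]) (by simp [pairsVars])
  refine fg_invariants_of_monic (p := p) (pairsVars k) (X 0 ^ 2 * X 1 ^ 2 * X 2 ^ 2) (thetaR7 k)
    ?_ ?_ (fixedSubalgebra_pairsVars_fg k) l b hl hb
  · intro i
    change aeval (r7Vars k) _ = _
    fin_cases i <;> simp [r7Vars, pairsVars]
  · change aeval (r7Vars k) _ = _
    rw [aeval_X]
    simp [r7Vars, Fin.last]

end

theorem theorem2p1 (p : ℕ) (hp : p.Prime) (k : Type*) [Field k] [CharP k p] :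
    (thetaDF5 k).invariants.FG ∧ (thetaF6 k).invariants.FG ∧ (thetaR7 k).invariants.FG := by
  have : Fact p.Prime := ⟨hp⟩
  exact ⟨thetaDF5_invariants_fg (p := p), thetaF6_invariants_fg (p := p),
    thetaR7_invariants_fg (p := p)⟩
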